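/- The Stern-Brocot intervals are defined inductively: $[\frac01,\frac10]=[0,\infty]$ is the only one of rank $0$, and each Stern-Brocot interval $[\frac ab,\frac cd]$ of rank $r$ is cut into two of rank $r+1$, the left one $[\frac ab,\frac{a+c}{b+d}]$ and the right one $[\frac{a+c}{b+d},\frac cd]$. For $0\le\alpha\le1$, let $\nu_\alpha$ be the unique Borel probability measure on $[0,\infty)$ such that, for every Stern-Brocot interval $I$ of rank $r$ with left and right subintervals $I_{\mathrm l}$ and $I_{\mathrm r}$ of rank $r+1$, $$\nu_\alpha(I_{\mathrm r})=\alpha\,\nu_\alpha(I),\quad \nu_\alpha(I_{\mathrm l})=(1-\alpha)\,\nu_\alpha(I)\quad\text{if the rank of } I \text{ is even},$$ $$\nu_\alpha(I_{\mathrm l})=\alpha\,\nu_\alpha(I),\quad \nu_\alpha(I_{\mathrm r})=(1-\alpha)\,\nu_\alpha(I)\quad\text{if the rank of } I \text{ is odd}$$ (the point $\infty$ is discarded), and put $\gamma(\alpha)=\int_0^\infty \log x\,d\nu_\alpha(x)$. Proposition. Let $1/2<\alpha\le 1$. Then $x\mapsto\log x$ is $\nu_\alpha$-integrable, $(x,y)\mapsto\log\frac{x+y+xy}{x+y+1}$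 is $\nu_\alpha\otimes\nu_\alpha$-integrable, and the function $\gamma:[0,1]\to\mathbb R$ is differentiable at $\alpha$ (from the left if $\alpha=1$), with derivative $$\gamma'(\alpha)=\gamma(\alpha)\,\frac{1+2\alpha-2\alpha^2}{(2\alpha-1)(\alpha^2-\alpha+1)}+\frac{2\alpha-1}{\alpha^2-\alpha+1}\int_0^\infty\!\!\int_0^\infty\log\frac{x+y+xy}{x+y+1}\,d(\nu_\alpha\otimes\nu_\alpha)(x,y).$$ -/

import Mathlib

open MeasureTheory

namespace SternBrocot

/-- `IsInterval r a b c d`: the interval `[a/b, c/d]` is a Stern-Brocot interval of rank `r`.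
The only one of rank `0` is `[0/1, 1/0]`, and each one of rank `r` is cut at its mediant
`(a+c)/(b+d)` into two of rank `r + 1`. -/
inductive IsInterval : ℕ → ℕ → ℕ → ℕ → ℕ → Prop
  | root : IsInterval 0 0 1 1 0
  | left {r a b c d : ℕ} (h : IsInterval r a b c d) : IsInterval (r + 1) a b (a + c) (b + d)
  | right {r a b c d : ℕ} (h : IsInterval r a b c d) : IsInterval (r + 1) (a + c) (b + d) c d

/-- The set of real points of `[a/b, c/d]`, for `b > 0`, with denominators cleared; for
`c/d = 1/0` the upper bound is void, so that `[a/b, 1/0]` is `[a/b, ∞)`. -/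
def interval (a b c d : ℕ) : Set ℝ :=
  {x : ℝ | (a : ℝ) ≤ b * x ∧ (d : ℝ) * x ≤ c}

/-- `μ` is a probability measure on `[0, ∞)` such that the mass of every Stern-Brocot interval
of rank `r` is shared between its two subintervals of rank `r + 1`, a proportion `α` going to the
right one if `r` is even and to the left one if `r` is odd. -/
structure IsNu (α : ℝ) (μ : Measure ℝ) : Prop where
  isProbabilityMeasure : IsProbabilityMeasure μ
  measure_neg : μ (Set.Iio 0) = 0
  even : ∀ r a b c d : ℕ, IsInterval r a b c d → Even r →
    μ.real (interval a b (a + c) (b + d)) = (1 - α) * μ.real (interval a b c d) ∧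
    μ.real (interval (a + c) (b + d) c d) = α * μ.real (interval a b c d)
  odd : ∀ r a b c d : ℕ, IsInterval r a b c d → Odd r →
    μ.real (interval a b (a + c) (b + d)) = α * μ.real (interval a b c d) ∧
    μ.real (interval (a + c) (b + d) c d) = (1 - α) * μ.real (interval a b c d)

/-! ### Existence and uniqueness of the measure -/

/-- Endpoints `(a, b, c, d)` of the interval of rank `n` reached from the root by the
directions `ω` (`true` is right). -/
def st (ω : ℕ → Bool) : ℕ → ℕ × ℕ × ℕ × ℕ
  | 0 => (0, 1, 1, 0)
  | n + 1 =>
    let s := st ω n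
    if ω n then (s.1 + s.2.2.1, s.2.1 + s.2.2.2, s.2.2.1, s.2.2.2)
    else (s.1, s.2.1, s.1 + s.2.2.1, s.2.1 + s.2.2.2)

/-- Left endpoint at rank `n`. -/
noncomputable def lo (ω : ℕ → Bool) (n : ℕ) : ℝ := ((st ω n).1 : ℝ) / ((st ω n).2.1 : ℝ)

/-- Limit of the left endpoints. -/
noncomputable def pt (ω : ℕ → Bool) : ℝ := ⨆ n, lo ω n

/-- Directions which are not eventually constant. -/
def Good (ω : ℕ → Bool) : Prop := ∀ b : Bool, ∀ n : ℕ, ∃ m, n ≤ m ∧ ω m = b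

theorem st_true {ω : ℕ → Bool} {n a b c d : ℕ} (hs : st ω n = (a, b, c, d)) (h : ω n = true) :
    st ω (n + 1) = (a + c, b + d, c, d) := by
  simp [st, hs, h]

theorem st_false {ω : ℕ → Bool} {n a b c d : ℕ} (hs : st ω n = (a, b, c, d)) (h : ω n = false) :
    st ω (n + 1) = (a, b, a + c, b + d) := by
  simp [st, hs, h]

theorem st_inv (ω : ℕ → Bool) (n : ℕ) : ∀ a b c d : ℕ, st ω n = (a, b, c, d) →
    0 < b ∧ b * c = a * d + 1 := by
  induction n with
  | zero => intro a b c d h; simp [st] at h; obtain ⟨rfl, rfl, rfl, rfl⟩ := h; simp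
  | succ n ih =>
    intro a b c d h
    obtain ⟨⟨a', b', c', d'⟩, hs⟩ : ∃ s, st ω n = s := ⟨_, rfl⟩
    obtain ⟨h1, h2⟩ := ih _ _ _ _ hs
    cases hb : ω n with
    | true =>
      rw [st_true hs hb] at h
      simp only [Prod.mk.injEq] at h
      obtain ⟨rfl, rfl, rfl, rfl⟩ := h
      exact ⟨by omega, by nlinarith⟩
    | false =>
      rw [st_false hs hb] at h
      simp only [Prod.mk.injEq] at h
      obtain ⟨rfl, rfl, rfl, rfl⟩ := h
      exact ⟨by omega, by nlinarith⟩

/-- Intervals further down are contained in the intervals above. -/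
theorem st_nested (ω : ℕ → Bool) {n a b c d : ℕ} (hs : st ω n = (a, b, c, d)) (m : ℕ)
    (hm : n ≤ m) : ∀ a' b' c' d' : ℕ, st ω m = (a', b', c', d') →
      a * b' ≤ a' * b ∧ a' * d ≤ c * b' ∧ a * d' ≤ c' * b ∧ c' * d ≤ c * d' := by
  induction m, hm using Nat.le_induction with
  | base =>
    intro a' b' c' d' h
    rw [hs] at h
    simp only [Prod.mk.injEq] at h
    obtain ⟨rfl, rfl, rfl, rfl⟩ := h
    have := (st_inv ω n _ _ _ _ hs).2
    refine ⟨le_rfl, by nlinarith, by nlinarith, le_rfl⟩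
  | succ m hm ih =>
    intro a' b' c' d' h
    obtain ⟨⟨a₁, b₁, c₁, d₁⟩, hs₁⟩ : ∃ s, st ω m = s := ⟨_, rfl⟩
    obtain ⟨h1, h2, h3, h4⟩ := ih _ _ _ _ hs₁
    cases hb : ω m with
    | true =>
      rw [st_true hs₁ hb] at h
      simp only [Prod.mk.injEq] at h
      obtain ⟨rfl, rfl, rfl, rfl⟩ := h
      refine ⟨by nlinarith, by nlinarith, by nlinarith, by nlinarith⟩
    | false =>
      rw [st_false hs₁ hb] at h
      simp only [Prod.mk.injEq] at h
      obtain ⟨rfl, rfl, rfl, rfl⟩ := h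
      refine ⟨by nlinarith, by nlinarith, by nlinarith, by nlinarith⟩

theorem st_next (ω : ℕ → Bool) {n a b c d : ℕ} (hs : st ω n = (a, b, c, d)) (β : Bool) (m : ℕ)
    (hm : n ≤ m) (hβ : ω m = β) : ∃ a' b' c' d', st ω (m + 1) = (a', b', c', d') ∧
      (if β then a * b' < a' * b else c' * d < c * d') := by
  obtain ⟨⟨a₁, b₁, c₁, d₁⟩, hs₁⟩ : ∃ s, st ω m = s := ⟨_, rfl⟩
  have hi := st_inv ω _ _ _ _ _ hs₁
  have hj := st_inv ω _ _ _ _ _ hs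
  obtain ⟨h1, h2, h3, h4⟩ := st_nested ω hs m hm _ _ _ _ hs₁
  cases β with
  | true =>
    refine ⟨_, _, _, _, st_true hs₁ hβ, ?_⟩
    simp only [if_true]
    rcases h1.lt_or_eq with h | h
    · nlinarith
    · rcases h3.lt_or_eq with h' | h'
      · nlinarith
      · exfalso
        -- the two endpoints would both equal `a / b`
        have e1 : a * (b₁ * c₁) = a * (a₁ * d₁) + a := by rw [hi.2]; ring
        have e2 : a * b₁ * c₁ = a₁ * (a * d₁) + a := by linarith [e1]
        rw [h', h] at e2
        have ha : a = 0 := by nlinarith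
        subst ha
        have hc : c₁ * b = 0 := by omega
        have ha₁ : a₁ * b = 0 := by omega
        have : c₁ = 0 := by rcases Nat.mul_eq_zero.1 hc with h | h <;> omega
        subst this
        omega
  | false =>
    refine ⟨_, _, _, _, st_false hs₁ hβ, ?_⟩
    simp only [Bool.false_eq_true, if_false]
    rcases h2.lt_or_eq with h | h
    · nlinarith
    · rcases h4.lt_or_eq with h' | h'
      · nlinarith
      · exfalso
        have e1 : c * (b₁ * c₁) = c * (a₁ * d₁) + c := by rw [hi.2]; ring
        have e2 : c * b₁ * c₁ = a₁ * (c * d₁) + c := by linarith [e1]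
        rw [← h', ← h] at e2
        have hc : c = 0 := by nlinarith
        subst hc
        omega

theorem lo_mono (ω : ℕ → Bool) : Monotone (lo ω) := by
  intro n m hm
  obtain ⟨⟨a, b, c, d⟩, hs⟩ : ∃ s, st ω n = s := ⟨_, rfl⟩
  obtain ⟨⟨a', b', c', d'⟩, hs'⟩ : ∃ s, st ω m = s := ⟨_, rfl⟩
  have hb : (0 : ℝ) < b := by exact_mod_cast (st_inv ω _ _ _ _ _ hs).1
  have hb' : (0 : ℝ) < b' := by exact_mod_cast (st_inv ω _ _ _ _ _ hs').1
  have h := (st_nested ω hs m hm _ _ _ _ hs').1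
  simp only [lo, hs, hs']
  rw [div_le_div_iff₀ hb hb']
  exact_mod_cast h

theorem lo_le (ω : ℕ → Bool) {n a b c d : ℕ} (hs : st ω n = (a, b, c, d)) (hd : 0 < d) (m : ℕ) :
    lo ω m ≤ (c : ℝ) / d := by
  refine (lo_mono ω (le_max_right n m)).trans ?_
  obtain ⟨⟨a', b', c', d'⟩, hs'⟩ : ∃ s, st ω (max n m) = s := ⟨_, rfl⟩
  have hb' : (0 : ℝ) < b' := by exact_mod_cast (st_inv ω _ _ _ _ _ hs').1
  have h := (st_nested ω hs _ (le_max_left n m) _ _ _ _ hs').2.1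
  simp only [lo, hs']
  rw [div_le_div_iff₀ hb' (by exact_mod_cast hd)]
  exact_mod_cast h

theorem pt_mem {ω : ℕ → Bool} (hω : Good ω) {n a b c d : ℕ} (hs : st ω n = (a, b, c, d)) :
    (a : ℝ) < b * pt ω ∧ (d : ℝ) * pt ω < c := by
  obtain ⟨m, hm, hβ⟩ := hω false n
  obtain ⟨a', b', c', d', hs', h'⟩ := st_next ω hs false m hm hβ
  simp only [Bool.false_eq_true, if_false] at h'
  have hd' : 0 < d' := by
    rcases Nat.eq_zero_or_pos d' with h | h
    · subst h; simp at h'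
    · exact h
  have hle : pt ω ≤ (c' : ℝ) / d' := ciSup_le fun k => lo_le ω hs' hd' k
  have hbdd : BddAbove (Set.range (lo ω)) := ⟨_, by rintro _ ⟨k, rfl⟩; exact lo_le ω hs' hd' k⟩
  have hb : (0 : ℝ) < b := by exact_mod_cast (st_inv ω _ _ _ _ _ hs).1
  constructor
  · obtain ⟨m, hm, hβ⟩ := hω true n
    obtain ⟨a₁, b₁, c₁, d₁, hs₁, h₁⟩ := st_next ω hs true m hm hβ
    simp only [if_true] at h₁
    have hge : lo ω (m + 1) ≤ pt ω := le_ciSup hbdd _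
    simp only [lo, hs₁] at hge
    have hb₁ : (0 : ℝ) < b₁ := by exact_mod_cast (st_inv ω _ _ _ _ _ hs₁).1
    have h₁' : (a : ℝ) * b₁ < a₁ * b := by exact_mod_cast h₁
    have : (a : ℝ) / b < a₁ / b₁ := by rw [div_lt_div_iff₀ hb hb₁]; exact h₁'
    have := this.trans_le hge
    rw [div_lt_iff₀ hb] at this
    linarith
  · have hd'' : (0 : ℝ) < d' := by exact_mod_cast hd'
    have h'' : (c' : ℝ) * d < c * d' := by exact_mod_cast h'
    rw [le_div_iff₀ hd''] at hle
    have : (d : ℝ) * (pt ω * d') ≤ d * c' := mul_le_mul_of_nonneg_left hle (by positivity)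
    nlinarith

/-- On good directions, `[a/b, c/d]` is described by the first `r` directions `w`. -/
def Codes (r a b c d : ℕ) (w : ℕ → Bool) : Prop :=
  (∀ ω, (∀ i < r, ω i = w i) → st ω r = (a, b, c, d)) ∧
  ∀ ω, Good ω → (pt ω ∈ interval a b c d ↔ ∀ i < r, ω i = w i)

theorem forall_lt_update {r : ℕ} {w ω : ℕ → Bool} {β : Bool} :
    (∀ i < r + 1, ω i = Function.update w r β i) ↔ (∀ i < r, ω i = w i) ∧ ω r = β := by
  constructor
  · intro h
    refine ⟨fun i hi => ?_, by simpa using h r (by omega)⟩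
    have := h i (by omega)
    rwa [Function.update_of_ne (by omega)] at this
  · rintro ⟨h, hr⟩ i hi
    rcases Nat.lt_succ_iff_lt_or_eq.1 hi with h' | rfl
    · rw [Function.update_of_ne (by omega)]; exact h i h'
    · simpa using hr

theorem Codes.left {r a b c d : ℕ} {w : ℕ → Bool} (h : Codes r a b c d w) :
    Codes (r + 1) a b (a + c) (b + d) (Function.update w r false) := by
  have h1 : ∀ ω, (∀ i < r + 1, ω i = Function.update w r false i) →
      st ω (r + 1) = (a, b, a + c, b + d) := by
    intro ω hω
    rw [forall_lt_update] at hω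
    exact st_false (h.1 ω hω.1) hω.2
  refine ⟨h1, fun ω hg => ⟨fun hx => ?_, fun hω => ?_⟩⟩
  · simp only [interval, Set.mem_ofPred_eq, Nat.cast_add] at hx
    have hp : ∀ i < r, ω i = w i := (h.2 ω hg).1 ⟨hx.1, by nlinarith [hx.1, hx.2]⟩
    rw [forall_lt_update]
    refine ⟨hp, ?_⟩
    cases hb : ω r with
    | false => rfl
    | true =>
      have := (pt_mem hg (st_true (h.1 ω hp) hb)).1
      push_cast at this
      linarith [hx.2]
  · have := pt_mem hg (h1 ω hω)
    exact ⟨this.1.le, this.2.le⟩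

theorem Codes.right {r a b c d : ℕ} {w : ℕ → Bool} (h : Codes r a b c d w) :
    Codes (r + 1) (a + c) (b + d) c d (Function.update w r true) := by
  have h1 : ∀ ω, (∀ i < r + 1, ω i = Function.update w r true i) →
      st ω (r + 1) = (a + c, b + d, c, d) := by
    intro ω hω
    rw [forall_lt_update] at hω
    exact st_true (h.1 ω hω.1) hω.2
  refine ⟨h1, fun ω hg => ⟨fun hx => ?_, fun hω => ?_⟩⟩
  · simp only [interval, Set.mem_ofPred_eq, Nat.cast_add] at hx
    have hp : ∀ i < r, ω i = w i := (h.2 ω hg).1 ⟨by nlinarith [hx.1, hx.2], hx.2⟩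
    rw [forall_lt_update]
    refine ⟨hp, ?_⟩
    cases hb : ω r with
    | true => rfl
    | false =>
      have := (pt_mem hg (st_false (h.1 ω hp) hb)).2
      push_cast at this
      linarith [hx.1]
  · have := pt_mem hg (h1 ω hω)
    exact ⟨this.1.le, this.2.le⟩

theorem pt_nonneg (ω : ℕ → Bool) : 0 ≤ pt ω :=
  Real.iSup_nonneg fun _ => div_nonneg (Nat.cast_nonneg _) (Nat.cast_nonneg _)

theorem exists_codes {r a b c d : ℕ} (h : IsInterval r a b c d) : ∃ w, Codes r a b c d w := by
  induction h with
  | root =>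
    refine ⟨fun _ => false, fun ω _ => rfl, fun ω _ => ?_⟩
    simp [interval, pt_nonneg]
  | left _ ih => obtain ⟨w, hw⟩ := ih; exact ⟨_, hw.left⟩
  | right _ ih => obtain ⟨w, hw⟩ := ih; exact ⟨_, hw.right⟩

/-- A biased coin. -/
noncomputable def coin (p : unitInterval) : Measure Bool :=
  ENNReal.ofReal p • Measure.dirac true + ENNReal.ofReal (1 - p) • Measure.dirac false

theorem coin_true (p : unitInterval) : coin p {true} = ENNReal.ofReal p := by
  simp [coin]

theorem coin_false (p : unitInterval) : coin p {false} = ENNReal.ofReal (1 - p) := by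
  simp [coin]

instance instIsProbabilityMeasureCoin (p : unitInterval) : IsProbabilityMeasure (coin p) := by
  constructor
  simp only [coin, Measure.coe_add, Measure.coe_smul, Pi.add_apply, Pi.smul_apply, measure_univ,
    smul_eq_mul, mul_one]
  rw [← ENNReal.ofReal_add p.2.1 (by linarith [p.2.2])]
  simp

/-- The law of the directions: at step `n`, right has probability `α` if `n` is even and
`1 - α` if `n` is odd. -/
noncomputable def dir (α : unitInterval) : Measure (ℕ → Bool) :=
  Measure.infinitePi fun n => coin (if Even n then α else unitInterval.symm α)

instance instIsProbabilityMeasureDir (α : unitInterval) : IsProbabilityMeasure (dir α) := by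
  unfold dir; infer_instance

theorem dir_cyl (α : unitInterval) (s : Finset ℕ) (w : ℕ → Bool) :
    dir α {ω | ∀ i ∈ s, ω i = w i} =
      ∏ i ∈ s, coin (if Even i then α else unitInterval.symm α) {w i} := by
  have := Measure.infinitePi_pi (fun n => coin (if Even n then α else unitInterval.symm α))
    (s := s) (t := fun i => {w i}) (fun _ _ => MeasurableSet.of_discrete)
  rw [← this, dir]
  congr 1

theorem measurable_st (n : ℕ) : Measurable fun ω : ℕ → Bool => st ω n := by
  induction n with
  | zero => exact measurable_const
  | succ n ih =>
    have : Measurable fun ω : ℕ → Bool => (st ω n, ω n) := ih.prodMk (measurable_pi_apply n)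
    exact (Measurable.of_discrete (f := fun q : (ℕ × ℕ × ℕ × ℕ) × Bool =>
      if q.2 then (q.1.1 + q.1.2.2.1, q.1.2.1 + q.1.2.2.2, q.1.2.2.1, q.1.2.2.2)
      else (q.1.1, q.1.2.1, q.1.1 + q.1.2.2.1, q.1.2.1 + q.1.2.2.2))).comp this

theorem measurable_pt : Measurable pt := by
  refine Measurable.iSup fun n => ?_
  exact (Measurable.of_discrete (f := fun q : ℕ × ℕ × ℕ × ℕ => (q.1 : ℝ) / (q.2.1 : ℝ))).comp
    (measurable_st n)

theorem dir_const (α : unitInterval) (β : Bool) (n : ℕ) :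
    dir α {ω | ∀ m, n ≤ m → ω m = β} = 0 := by
  set p : ℕ → unitInterval := fun i => if Even i then α else unitInterval.symm α with hp
  have key : ∀ i, coin (p i) {β} * coin (p (i + 1)) {β} ≤ ENNReal.ofReal (1 / 4) := by
    intro i
    have ha : (0 : ℝ) ≤ (α : ℝ) := α.2.1
    have ha' : (0 : ℝ) ≤ 1 - (α : ℝ) := by linarith [α.2.2]
    have : ENNReal.ofReal α * ENNReal.ofReal (1 - α) ≤ ENNReal.ofReal (1 / 4) := by
      rw [← ENNReal.ofReal_mul ha]
      exact ENNReal.ofReal_le_ofReal (by nlinarith [sq_nonneg ((α : ℝ) - 1 / 2)])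
    have this' := this
    rw [mul_comm] at this'
    rcases Nat.even_or_odd i with h | h
    · have h' : ¬ Even (i + 1) := by simp [Nat.even_add_one, h]
      cases β <;> simp only [hp, h, h', coin_true, coin_false, if_true, if_false,
        unitInterval.coe_symm_eq, sub_sub_cancel] <;> assumption
    · have h₀ : ¬ Even i := Nat.not_even_iff_odd.2 h
      have h' : Even (i + 1) := by simp [Nat.even_add_one, h₀]
      cases β <;> simp only [hp, h₀, h', coin_true, coin_false, if_true, if_false,
        unitInterval.coe_symm_eq, sub_sub_cancel] <;> assumption
  have bound : ∀ k, ∏ i ∈ Finset.range (2 * k), coin (p (n + i)) {β} ≤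
      ENNReal.ofReal (1 / 4) ^ k := by
    intro k
    induction k with
    | zero => simp
    | succ k ih =>
      rw [show 2 * (k + 1) = 2 * k + 1 + 1 by ring, Finset.prod_range_succ,
        Finset.prod_range_succ, mul_assoc, pow_succ]
      exact mul_le_mul' ih (key (n + 2 * k))
  refine le_antisymm ?_ zero_le
  refine ge_of_tendsto' (ENNReal.tendsto_pow_atTop_nhds_zero_of_lt_one (r := ENNReal.ofReal (1 / 4))
    (by rw [ENNReal.ofReal_lt_one]; norm_num)) fun k => ?_
  refine le_trans ?_ (bound k)
  have := dir_cyl α (Finset.Ico n (n + 2 * k)) (fun _ => β)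
  rw [Finset.prod_Ico_eq_prod_range] at this
  simp only [Nat.add_sub_cancel_left] at this
  rw [← this]
  exact measure_mono fun ω hω i hi => hω i (Finset.mem_Ico.1 hi).1

theorem ae_good (α : unitInterval) : ∀ᵐ ω ∂(dir α), Good ω := by
  unfold Good
  rw [ae_all_iff]
  intro β
  rw [ae_all_iff]
  intro n
  rw [ae_iff]
  refine measure_mono_null ?_ (dir_const α (!β) n)
  intro ω hω
  simp only [Set.mem_ofPred_eq, not_exists, not_and] at hω
  intro m hm
  have := hω m hm
  cases h : ω m <;> cases β <;> simp_all

theorem measurableSet_interval (a b c d : ℕ) : MeasurableSet (interval a b c d) := by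
  have h1 : MeasurableSet {x : ℝ | (a : ℝ) ≤ b * x} :=
    measurableSet_le measurable_const (by fun_prop)
  have h2 : MeasurableSet {x : ℝ | (d : ℝ) * x ≤ c} :=
    measurableSet_le (by fun_prop) measurable_const
  exact h1.inter h2

theorem map_interval (α : unitInterval) {r a b c d : ℕ} {w : ℕ → Bool} (h : Codes r a b c d w) :
    ((dir α).map pt) (interval a b c d) =
      ∏ i ∈ Finset.range r, coin (if Even i then α else unitInterval.symm α) {w i} := by
  rw [Measure.map_apply measurable_pt (measurableSet_interval a b c d), ← dir_cyl]
  refine measure_congr ?_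
  filter_upwards [ae_good α] with ω hω
  have := h.2 ω hω
  simp only [eq_iff_iff, Finset.mem_range]
  exact this

theorem prod_update (m : ℕ → Measure Bool) (r : ℕ) (w : ℕ → Bool) (β : Bool) :
    ∏ i ∈ Finset.range (r + 1), m i {Function.update w r β i} =
      m r {β} * ∏ i ∈ Finset.range r, m i {w i} := by
  rw [Finset.prod_range_succ, mul_comm]
  congr 1
  · simp
  · refine Finset.prod_congr rfl fun i hi => ?_
    rw [Function.update_of_ne (Finset.mem_range.1 hi).ne]

theorem isNu_map (α : unitInterval) : IsNu (α : ℝ) ((dir α).map pt) := by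
  have ha : (0 : ℝ) ≤ (α : ℝ) := α.2.1
  have ha' : (α : ℝ) ≤ 1 := α.2.2
  refine ⟨Measure.isProbabilityMeasure_map measurable_pt.aemeasurable, ?_, ?_, ?_⟩
  · rw [Measure.map_apply measurable_pt measurableSet_Iio]
    convert measure_empty (μ := dir α)
    ext ω
    simpa using pt_nonneg ω
  · intro r a b c d h hr
    obtain ⟨w, hw⟩ := exists_codes h
    simp only [Measure.real, map_interval α hw, map_interval α hw.left, map_interval α hw.right]
    constructor <;> rw [prod_update (fun i => coin (if Even i then α else unitInterval.symm α)),
      ENNReal.toReal_mul] <;> simp [hr, coin_true, coin_false, ha, ha']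
  · intro r a b c d h hr
    have hr' : ¬ Even r := Nat.not_even_iff_odd.2 hr
    obtain ⟨w, hw⟩ := exists_codes h
    simp only [Measure.real, map_interval α hw, map_interval α hw.left, map_interval α hw.right]
    constructor <;> rw [prod_update (fun i => coin (if Even i then α else unitInterval.symm α)),
      ENNReal.toReal_mul] <;> simp [hr', coin_true, coin_false, ha, ha']

theorem IsInterval.det {r a b c d : ℕ} (h : IsInterval r a b c d) :
    0 < b ∧ 0 < c ∧ b * c = a * d + 1 := by
  induction h with
  | root => simp
  | left _ ih => obtain ⟨h1, h2, h3⟩ := ih; exact ⟨h1, by omega, by nlinarith⟩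
  | right _ ih => obtain ⟨h1, h2, h3⟩ := ih; exact ⟨by omega, h2, by nlinarith⟩

/-- Every rational point in the interior of a Stern-Brocot interval is a mediant. -/
theorem IsInterval.exists_mediant (N : ℕ) : ∀ r a b c d p q : ℕ, IsInterval r a b c d →
    a * q < p * b → p * d < c * q → p + q ≤ N + (a + b + c + d) →
    ∃ r' a' b' c' d', IsInterval r' a' b' c' d' ∧ (a' + c') * q = p * (b' + d') := by
  induction N with
  | zero =>
    intro r a b c d p q h h1 h2 hN
    refine ⟨r, a, b, c, d, h, ?_⟩
    obtain ⟨hb, hc, hdet⟩ := h.det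
    obtain ⟨u, hu⟩ := Nat.exists_eq_add_of_lt h1
    obtain ⟨v, hv⟩ := Nat.exists_eq_add_of_lt h2
    zify at *
    have hp : (p : ℤ) = a * (v + 1) + c * (u + 1) := by
      linear_combination (-p : ℤ) * hdet + c * hu + a * hv
    have hq : (q : ℤ) = b * (v + 1) + d * (u + 1) := by
      linear_combination (-q : ℤ) * hdet + d * hu + b * hv
    have hu0 : (0 : ℤ) ≤ u := by positivity
    have hv0 : (0 : ℤ) ≤ v := by positivity
    have ha0 : (0 : ℤ) ≤ a := by positivity
    have hd0 : (0 : ℤ) ≤ d := by positivity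
    have hv' : (v : ℤ) = 0 := by nlinarith [mul_nonneg ha0 hv0, mul_nonneg hd0 hu0, mul_nonneg hc.le hu0]
    have hu' : (u : ℤ) = 0 := by nlinarith [mul_nonneg ha0 hv0, mul_nonneg hd0 hu0, mul_nonneg hb.le hv0]
    rw [hp, hq, hu', hv']
    ring
  | succ N ih =>
    intro r a b c d p q h h1 h2 hN
    obtain ⟨hb, hc, hdet⟩ := h.det
    rcases lt_trichotomy ((a + c) * q) (p * (b + d)) with hlt | heq | hgt
    · exact ih _ _ _ _ _ p q h.right hlt h2 (by omega)
    · exact ⟨r, a, b, c, d, h, heq⟩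
    · exact ih _ _ _ _ _ p q h.left h1 hgt (by omega)

/-- The two subintervals have the whole mass, so that the mediant has mass zero. -/
theorem IsNu.add {α : ℝ} {μ : Measure ℝ} (h : IsNu α μ) {r a b c d : ℕ}
    (hI : IsInterval r a b c d) :
    μ.real (interval a b (a + c) (b + d)) + μ.real (interval (a + c) (b + d) c d) =
      μ.real (interval a b c d) := by
  rcases Nat.even_or_odd r with hr | hr
  · rw [(h.even r a b c d hI hr).1, (h.even r a b c d hI hr).2]; ring
  · rw [(h.odd r a b c d hI hr).1, (h.odd r a b c d hI hr).2]; ring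

theorem interval_union {r a b c d : ℕ} (hI : IsInterval r a b c d) :
    interval a b (a + c) (b + d) ∪ interval (a + c) (b + d) c d = interval a b c d := by
  obtain ⟨hb, hc, hdet⟩ := hI.det
  have hb' : (0 : ℝ) < b := by exact_mod_cast hb
  have hd' : (0 : ℝ) ≤ d := Nat.cast_nonneg d
  have hdet' : (b : ℝ) * c = a * d + 1 := by exact_mod_cast hdet
  ext x
  simp only [interval, Set.mem_union, Set.mem_ofPred_eq, Nat.cast_add]
  constructor
  · rintro (⟨h1, h2⟩ | ⟨h1, h2⟩)
    · exact ⟨h1, by linarith⟩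
    · exact ⟨by linarith, h2⟩
  · rintro ⟨h1, h2⟩
    rcases le_total ((b + d : ℝ) * x) (a + c) with h | h
    · exact Or.inl ⟨h1, h⟩
    · exact Or.inr ⟨h, h2⟩

theorem IsNu.mediant_null {α : ℝ} {μ : Measure ℝ} (h : IsNu α μ) {r a b c d : ℕ}
    (hI : IsInterval r a b c d) : μ.real {x : ℝ | ((b + d : ℕ) : ℝ) * x = (a + c : ℕ)} = 0 := by
  have := h.isProbabilityMeasure
  have h1 := measureReal_union_add_inter (μ := μ) (s := interval a b (a + c) (b + d))
    (measurableSet_interval (a + c) (b + d) c d)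
  rw [interval_union hI, h.add hI] at h1
  have h2 : μ.real (interval a b (a + c) (b + d) ∩ interval (a + c) (b + d) c d) = 0 := by linarith
  rw [← h2]
  congr 1
  obtain ⟨hb, hc, hdet⟩ := hI.det
  have hb' : (0 : ℝ) < b := by exact_mod_cast hb
  have hd' : (0 : ℝ) ≤ d := Nat.cast_nonneg d
  have hdet' : (b : ℝ) * c = a * d + 1 := by exact_mod_cast hdet
  ext x
  simp only [interval, Set.mem_inter_iff, Set.mem_ofPred_eq, Nat.cast_add]
  constructor
  · intro hx
    have hbd : (0 : ℝ) < b + d := by linarith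
    have e1 : (b + d : ℝ) * (b * x - a) = 1 := by linear_combination (b : ℝ) * hx + hdet'
    have e2 : (b + d : ℝ) * (c - d * x) = 1 := by linear_combination (-d : ℝ) * hx + hdet'
    have p1 : 0 < (b : ℝ) * x - a := by
      by_contra hn
      nlinarith
    have p2 : 0 < (c : ℝ) - d * x := by
      by_contra hn
      nlinarith
    exact ⟨⟨by linarith, hx.le⟩, hx.ge, by linarith⟩
  · rintro ⟨⟨_, h1⟩, h2, _⟩
    linarith

/-- Two measures with the defining property give the same mass to every Stern-Brocot interval. -/
theorem IsNu.interval_eq {α : ℝ} {μ ν : Measure ℝ} (hμ : IsNu α μ) (hν : IsNu α ν)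
    {r a b c d : ℕ} (hI : IsInterval r a b c d) :
    μ.real (interval a b c d) = ν.real (interval a b c d) := by
  have := hμ.isProbabilityMeasure
  have := hν.isProbabilityMeasure
  have root : ∀ {μ : Measure ℝ}, IsNu α μ → μ.real (interval 0 1 1 0) = 1 := by
    intro μ h
    have := h.isProbabilityMeasure
    have e : (interval 0 1 1 0) = (Set.Iio (0 : ℝ))ᶜ := by
      ext x; simp [interval]
    rw [e, probReal_compl_eq_one_sub measurableSet_Iio, Measure.real, h.measure_neg]
    simp
  induction hI with
  | root => rw [root hμ, root hν]
  | @left r a b c d hI ih =>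
    rcases Nat.even_or_odd r with hr | hr
    · rw [(hμ.even r a b c d hI hr).1, (hν.even r a b c d hI hr).1, ih]
    · rw [(hμ.odd r a b c d hI hr).1, (hν.odd r a b c d hI hr).1, ih]
  | @right r a b c d hI ih =>
    rcases Nat.even_or_odd r with hr | hr
    · rw [(hμ.even r a b c d hI hr).2, (hν.even r a b c d hI hr).2, ih]
    · rw [(hμ.odd r a b c d hI hr).2, (hν.odd r a b c d hI hr).2, ih]

/-- Mass to the left of a mediant. -/
theorem IsNu.Iio_mediant {α : ℝ} {μ : Measure ℝ} (h : IsNu α μ) {r a b c d : ℕ}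
    (hI : IsInterval r a b c d) :
    μ.real {x : ℝ | ((b + d : ℕ) : ℝ) * x < (a + c : ℕ)} =
      μ.real {x : ℝ | (b : ℝ) * x < a} + μ.real (interval a b (a + c) (b + d)) := by
  have := h.isProbabilityMeasure
  obtain ⟨hb, hc, hdet⟩ := hI.det
  have hb' : (0 : ℝ) < b := by exact_mod_cast hb
  have hd' : (0 : ℝ) ≤ d := Nat.cast_nonneg d
  have hdet' : (b : ℝ) * c = a * d + 1 := by exact_mod_cast hdet
  rw [← measureReal_union _ (measurableSet_interval _ _ _ _)]
  · have h0 := h.mediant_null hI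
    rw [← add_zero (μ.real {x : ℝ | ((b + d : ℕ) : ℝ) * x < (a + c : ℕ)}), ← h0,
      ← measureReal_union _ (measurableSet_eq_fun (by fun_prop) (by fun_prop))]
    · congr 1
      ext x
      simp only [interval, Set.mem_union, Set.mem_ofPred_eq, Nat.cast_add]
      rw [← le_iff_lt_or_eq]
      constructor
      · intro hx
        rcases lt_or_ge ((b : ℝ) * x) a with h | h
        · exact Or.inl h
        · exact Or.inr ⟨h, hx⟩
      · rintro (h | h)
        · have : (b : ℝ) * ((b + d : ℝ) * x) ≤ b * (a + c) := by nlinarith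
          exact le_of_mul_le_mul_left this hb'
        · exact h.2
    · exact Set.disjoint_left.2 fun x hx hx' => (ne_of_lt hx) hx'
  · exact Set.disjoint_left.2 fun x hx hx' => not_le_of_gt hx hx'.1

theorem IsNu.Iio_eq {α : ℝ} {μ ν : Measure ℝ} (hμ : IsNu α μ) (hν : IsNu α ν)
    {r a b c d : ℕ} (hI : IsInterval r a b c d) :
    μ.real {x : ℝ | (b : ℝ) * x < a} = ν.real {x : ℝ | (b : ℝ) * x < a} := by
  induction hI with
  | root =>
    have : {x : ℝ | ((1 : ℕ) : ℝ) * x < (0 : ℕ)} = Set.Iio 0 := by ext x; simp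
    rw [this, Measure.real, Measure.real, hμ.measure_neg, hν.measure_neg]
  | left _ ih => exact ih
  | right hI ih => rw [hμ.Iio_mediant hI, hν.Iio_mediant hI, ih, hμ.interval_eq hν hI.left]

theorem IsNu.unique {α : ℝ} {μ ν : Measure ℝ} (hμ : IsNu α μ) (hν : IsNu α ν) : μ = ν := by
  have := hμ.isProbabilityMeasure
  have := hν.isProbabilityMeasure
  refine MeasureTheory.ext_of_generate_finite (⋃ a : ℚ, {Set.Iio (a : ℝ)})
    (by rw [← Real.borel_eq_generateFrom_Iio_rat]; exact BorelSpace.measurable_eq)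
    Real.isPiSystem_Iio_rat ?_ (by simp)
  intro s hs
  simp only [Set.mem_iUnion, Set.mem_singleton_iff] at hs
  obtain ⟨x, rfl⟩ := hs
  rcases le_or_gt x 0 with hx | hx
  · have hsub : Set.Iio (x : ℝ) ⊆ Set.Iio 0 := Set.Iio_subset_Iio (by exact_mod_cast hx)
    rw [measure_mono_null hsub hμ.measure_neg, measure_mono_null hsub hν.measure_neg]
  · obtain ⟨p, hp⟩ : ∃ p : ℕ, (p : ℤ) = x.num := ⟨x.num.toNat, Int.toNat_of_nonneg (by
      have := Rat.num_pos.2 hx; omega)⟩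
    have hp0 : 0 < p := by have := Rat.num_pos.2 hx; omega
    have hq0 : 0 < x.den := x.den_pos
    have hxr : (x : ℝ) = (p : ℝ) / x.den := by
      rw [Rat.cast_def, ← hp]; simp
    obtain ⟨r, a, b, c, d, hI, he⟩ := IsInterval.exists_mediant (p + x.den) 0 0 1 1 0 p x.den
      IsInterval.root (by simpa using hp0) (by simpa using hq0) (by omega)
    have hbd : (0 : ℝ) < (b + d : ℕ) := by have := hI.det.1; exact_mod_cast (by omega)
    have hq0' : (0 : ℝ) < x.den := by exact_mod_cast hq0
    have he' : ((a + c : ℕ) : ℝ) * x.den = p * (b + d : ℕ) := by exact_mod_cast he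
    have hset : Set.Iio (x : ℝ) = {y : ℝ | ((b + d : ℕ) : ℝ) * y < (a + c : ℕ)} := by
      ext y
      have : (x : ℝ) = ((a + c : ℕ) : ℝ) / (b + d : ℕ) := by
        rw [hxr, div_eq_div_iff hq0'.ne' hbd.ne', he']
      rw [Set.mem_Iio, Set.mem_ofPred_eq, this, lt_div_iff₀ hbd, mul_comm]
    have := hμ.Iio_eq hν hI.right
    rw [hset]
    rwa [measureReal_def, measureReal_def,
      ENNReal.toReal_eq_toReal_iff' (measure_ne_top _ _) (measure_ne_top _ _)] at this

theorem existsUnique_nu {α : ℝ} (hα : α ∈ Set.Icc (0 : ℝ) 1) : ∃! μ : Measure ℝ, IsNu α μ :=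
  ⟨_, isNu_map ⟨α, hα⟩, fun _ h => h.unique (isNu_map ⟨α, hα⟩)⟩

end SternBrocot

open Classical in
/-- For `0 ≤ α ≤ 1`, the unique probability measure `ν_α` on `[0, ∞)` given by the inductive
rule `SternBrocot.IsNu α` (and `0` for other values of `α`, which are not used). -/
noncomputable def nu (α : ℝ) : Measure ℝ :=
  if hα : α ∈ Set.Icc (0 : ℝ) 1 then (SternBrocot.existsUnique_nu hα).choose else 0

theorem nu_spec {α : ℝ} (hα : α ∈ Set.Icc (0 : ℝ) 1) : SternBrocot.IsNu α (nu α) := by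
  rw [nu, dif_pos hα]
  exact (SternBrocot.existsUnique_nu hα).choose_spec.1

/-- `γ(α) = ∫ log x dν_α(x)`, where `ν_α` lives on `[0, ∞)`. -/
noncomputable def gammaLyap (α : ℝ) : ℝ := ∫ x, Real.log x ∂(nu α)

namespace SternBrocot

/-! ### Stationarity -/

/-! The measure ν_α is stationary: if X has law ν_α, then so has the variable equal to 1 + 1/X with
probability α and to 1/(1 + X) with probability 1 - α. Both maps raise the rank of Stern-Brocot
intervals by one and reverse orientation, and these two changes cancel in the parity rule;
uniqueness concludes (`IsNu.step_eq`).

Stationarity bounds the means of X and 1/X, so all the logarithms are integrable. Applied to log, it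
ties ∫ log(1 + x) to γ(α) (`IsNu.integral_log`). Hence the potential P(α) = ∫ (α log x + (1 - α)
log(1 + x)) dν_α satisfies (2α - 1) P(α) = (α² - α + 1) γ(α).

The key is the symmetric kernel log(1 + xy), integrated against ν_β ⊗ ν_α. Stationarity in x, or in
y, expresses it by the same two double integrals, with weights β, 1 - β or α, 1 - α. Equating gives
the exact formula P(β) - P(α) = (β - α) ∫∫ log((x + y + xy)/(x + y + 1)) dν_α(y) dν_β(x)
(`IsNu.sub_eq`).

So P'(α) is the limit of this double integral as β tends to α. It exists because ν_β is weakly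
continuous in β, by a coupling of the random directions, and because the inner integral is bounded
and continuous in x. The product rule for γ = P · (2α - 1)/(α² - α + 1) finishes the proof. -/

theorem IsNu.ae_pos {α : ℝ} {μ : Measure ℝ} (h : IsNu α μ) (hα : α ∈ Set.Icc (0 : ℝ) 1) :
    ∀ᵐ x ∂μ, 0 < x := by
  -- Almost every sequence of directions is good, and the point of a good sequence is interior to
  -- each of its intervals, in particular to the root.
  rw [h.unique (isNu_map ⟨α, hα⟩), ae_map_iff measurable_pt.aemeasurable measurableSet_Ioi]
  filter_upwards [ae_good ⟨α, hα⟩] with ω hω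
  simpa using (pt_mem hω (n := 0) (a := 0) (b := 1) (c := 1) (d := 0) rfl).1

theorem IsNu.real_root {α : ℝ} {μ : Measure ℝ} (h : IsNu α μ) :
    μ.real (interval 0 1 1 0) = 1 := by
  have := h.isProbabilityMeasure
  have e : interval 0 1 1 0 = (Set.Iio (0 : ℝ))ᶜ := by
    ext x; simp [interval]
  rw [e, probReal_compl_eq_one_sub measurableSet_Iio, Measure.real, h.measure_neg]
  simp

/-- A Stern-Brocot interval of positive rank is the image of one of the previous rank by
`x ↦ 1 + 1 / x` or by `x ↦ 1 / (1 + x)`. -/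
theorem IsInterval.exists_preimage {n a b c d : ℕ} (h : IsInterval n a b c d) :
    ∀ r, n = r + 1 → ∃ p q s t, IsInterval r p q s t ∧
      ((s + t = a ∧ s = b ∧ p + q = c ∧ p = d) ∨ (t = a ∧ s + t = b ∧ q = c ∧ p + q = d)) := by
  induction h with
  | root => intro r hr; omega
  | @left n a b c d h ih =>
    intro r hr
    obtain rfl : n = r := by omega
    -- At rank 1, [0, 1] is the image of the root by 1/(1 + x), and [1, ∞] is its image by 1 + 1/x.
    -- Beyond that, both maps are decreasing, so the left half of an image comes from the right half
    -- of the preimage, and conversely.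
    rcases n with _ | n
    · cases h
      exact ⟨0, 1, 1, 0, IsInterval.root, by simp⟩
    · obtain ⟨p, q, s, t, hJ, hs⟩ := ih n rfl
      refine ⟨_, _, _, _, hJ.right, ?_⟩
      omega
  | @right n a b c d h ih =>
    intro r hr
    obtain rfl : n = r := by omega
    rcases n with _ | n
    · cases h
      exact ⟨0, 1, 1, 0, IsInterval.root, by simp⟩
    · obtain ⟨p, q, s, t, hJ, hs⟩ := ih n rfl
      refine ⟨_, _, _, _, hJ.left, ?_⟩
      omega

/-- The map decreases and exchanges the roles of the endpoints p/q and s/t. With denominators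
cleared, each defining inequality is multiplied by x⁻¹ > 0. -/
theorem one_add_inv_mem_iff {p q s t : ℕ} {x : ℝ} (hx : 0 < x) :
    1 + x⁻¹ ∈ interval (s + t) s (p + q) p ↔ x ∈ interval p q s t := by
  simp only [interval, Set.mem_ofPred_eq, Nat.cast_add]
  have e : x * x⁻¹ = 1 := mul_inv_cancel₀ hx.ne'
  have hi : 0 < x⁻¹ := by positivity
  have e1 : (s : ℝ) * (1 + x⁻¹) - (s + t) = x⁻¹ * (s - t * x) := by linear_combination (t : ℝ) * e
  have e2 : (p + q : ℝ) - p * (1 + x⁻¹) = x⁻¹ * (q * x - p) := by linear_combination (-q : ℝ) * e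
  rw [← sub_nonneg, e1, ← sub_nonneg (b := (p : ℝ) * (1 + x⁻¹)), e2,
    mul_nonneg_iff_of_pos_left hi, mul_nonneg_iff_of_pos_left hi, sub_nonneg, sub_nonneg, and_comm]

theorem inv_one_add_mem_iff {p q s t : ℕ} {x : ℝ} (hx : 0 < x) :
    (1 + x)⁻¹ ∈ interval t (s + t) q (p + q) ↔ x ∈ interval p q s t := by
  simp only [interval, Set.mem_ofPred_eq, Nat.cast_add]
  have e : (1 + x) * (1 + x)⁻¹ = 1 := mul_inv_cancel₀ (by positivity)
  have hi : 0 < (1 + x)⁻¹ := by positivity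
  have e1 : (s + t : ℝ) * (1 + x)⁻¹ - t = (1 + x)⁻¹ * (s - t * x) := by
    linear_combination (t : ℝ) * e
  have e2 : (q : ℝ) - (p + q) * (1 + x)⁻¹ = (1 + x)⁻¹ * (q * x - p) := by
    linear_combination (-q : ℝ) * e
  rw [← sub_nonneg, e1, ← sub_nonneg (b := (p + q : ℝ) * (1 + x)⁻¹), e2,
    mul_nonneg_iff_of_pos_left hi, mul_nonneg_iff_of_pos_left hi, sub_nonneg, sub_nonneg, and_comm]

/-- The two branches have disjoint images of (0, ∞): this one lands below 1, while the interval
starts at (s + t)/s ≥ 1. -/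
theorem inv_one_add_notMem {p q s t : ℕ} {x : ℝ} (hx : 0 < x) (hs : 0 < s) :
    (1 + x)⁻¹ ∉ interval (s + t) s (p + q) p := by
  simp only [interval, Set.mem_ofPred_eq, Nat.cast_add, not_and]
  intro h
  have hs' : (0 : ℝ) < s := by exact_mod_cast hs
  have : (1 + x)⁻¹ < 1 := inv_lt_one_of_one_lt₀ (by linarith)
  nlinarith [(Nat.cast_nonneg t : (0 : ℝ) ≤ t)]

theorem one_add_inv_notMem {p q s t : ℕ} {x : ℝ} (hx : 0 < x) (hq : 0 < q) :
    1 + x⁻¹ ∉ interval t (s + t) q (p + q) := by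
  simp only [interval, Set.mem_ofPred_eq, Nat.cast_add, not_and, not_le]
  intro h
  have hq' : (0 : ℝ) < q := by exact_mod_cast hq
  have hi : 0 < x⁻¹ := by positivity
  nlinarith [(Nat.cast_nonneg p : (0 : ℝ) ≤ p), mul_pos hq' hi,
    mul_nonneg (Nat.cast_nonneg p : (0 : ℝ) ≤ p) hi.le]

theorem measurable_one_add_inv : Measurable fun x : ℝ => 1 + x⁻¹ := by fun_prop

theorem measurable_inv_one_add : Measurable fun x : ℝ => (1 + x)⁻¹ := by fun_prop

/-- The law of `1 + 1 / X` with probability `α` and of `1 / (1 + X)` otherwise, for `X` of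
law `μ`. -/
noncomputable def step (α : ℝ) (μ : Measure ℝ) : Measure ℝ :=
  ENNReal.ofReal α • μ.map (fun x => 1 + x⁻¹) + ENNReal.ofReal (1 - α) • μ.map fun x => (1 + x)⁻¹

theorem IsNu.step_real {α : ℝ} {μ : Measure ℝ} (h : IsNu α μ) (hα : α ∈ Set.Icc (0 : ℝ) 1)
    {s : Set ℝ} (hs : MeasurableSet s) :
    (step α μ).real s = α * μ.real ((fun x => 1 + x⁻¹) ⁻¹' s) +
      (1 - α) * μ.real ((fun x => (1 + x)⁻¹) ⁻¹' s) := by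
  have := h.isProbabilityMeasure
  have h1 : 0 ≤ 1 - α := by linarith [hα.2]
  rw [step, measureReal_def, Measure.add_apply, Measure.smul_apply, Measure.smul_apply,
    Measure.map_apply measurable_one_add_inv hs, Measure.map_apply measurable_inv_one_add hs,
    smul_eq_mul, smul_eq_mul, ENNReal.toReal_add, ENNReal.toReal_mul, ENNReal.toReal_mul,
    ENNReal.toReal_ofReal hα.1, ENNReal.toReal_ofReal h1]
  · rfl
  · exact ENNReal.mul_ne_top ENNReal.ofReal_ne_top (measure_ne_top _ _)
  · exact ENNReal.mul_ne_top ENNReal.ofReal_ne_top (measure_ne_top _ _)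

/-- An interval to the right of 1 is reached only through the branch 1 + x⁻¹, which has weight α. -/
theorem IsNu.step_real_right {α : ℝ} {μ : Measure ℝ} (h : IsNu α μ)
    (hα : α ∈ Set.Icc (0 : ℝ) 1) {r p q s t : ℕ} (hI : IsInterval r p q s t) :
    (step α μ).real (interval (s + t) s (p + q) p) = α * μ.real (interval p q s t) := by
  have := h.isProbabilityMeasure
  rw [h.step_real hα (measurableSet_interval _ _ _ _)]
  have e1 : μ.real ((fun x => 1 + x⁻¹) ⁻¹' interval (s + t) s (p + q) p) =
      μ.real (interval p q s t) := by
    refine measureReal_congr ?_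
    filter_upwards [h.ae_pos hα] with x hx
    exact propext (one_add_inv_mem_iff hx)
  have e2 : μ.real ((fun x => (1 + x)⁻¹) ⁻¹' interval (s + t) s (p + q) p) = 0 := by
    rw [← measureReal_empty (μ := μ)]
    refine measureReal_congr ?_
    filter_upwards [h.ae_pos hα] with x hx
    exact propext (iff_of_false (inv_one_add_notMem hx hI.det.2.1) id)
  rw [e1, e2, mul_zero, add_zero]

theorem IsNu.step_real_left {α : ℝ} {μ : Measure ℝ} (h : IsNu α μ)
    (hα : α ∈ Set.Icc (0 : ℝ) 1) {r p q s t : ℕ} (hI : IsInterval r p q s t) :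
    (step α μ).real (interval t (s + t) q (p + q)) = (1 - α) * μ.real (interval p q s t) := by
  have := h.isProbabilityMeasure
  rw [h.step_real hα (measurableSet_interval _ _ _ _)]
  have e1 : μ.real ((fun x => (1 + x)⁻¹) ⁻¹' interval t (s + t) q (p + q)) =
      μ.real (interval p q s t) := by
    refine measureReal_congr ?_
    filter_upwards [h.ae_pos hα] with x hx
    exact propext (inv_one_add_mem_iff hx)
  have e2 : μ.real ((fun x => 1 + x⁻¹) ⁻¹' interval t (s + t) q (p + q)) = 0 := by
    rw [← measureReal_empty (μ := μ)]
    refine measureReal_congr ?_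
    filter_upwards [h.ae_pos hα] with x hx
    exact propext (iff_of_false (one_add_inv_notMem hx hI.det.1) id)
  rw [e1, e2, mul_zero, zero_add]

/-- At rank 0 the rule is the choice of the branch. At higher rank an interval is the image of one
of the previous rank with its halves exchanged: the parity flips and the sides flip, so the
proportions are the prescribed ones. -/
theorem IsNu.step {α : ℝ} {μ : Measure ℝ} (h : IsNu α μ) (hα : α ∈ Set.Icc (0 : ℝ) 1) :
    IsNu α (step α μ) := by
  have := h.isProbabilityMeasure
  have hneg : (SternBrocot.step α μ).real (Set.Iio 0) = 0 := by
    rw [h.step_real hα measurableSet_Iio]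
    have e1 : μ.real ((fun x => 1 + x⁻¹) ⁻¹' Set.Iio 0) = 0 := by
      refine (measureReal_congr (t := ∅) ?_).trans measureReal_empty
      filter_upwards [h.ae_pos hα] with x hx
      exact propext (iff_of_false (not_lt.2 (show 0 ≤ 1 + x⁻¹ by positivity)) id)
    have e2 : μ.real ((fun x => (1 + x)⁻¹) ⁻¹' Set.Iio 0) = 0 := by
      refine (measureReal_congr (t := ∅) ?_).trans measureReal_empty
      filter_upwards [h.ae_pos hα] with x hx
      exact propext (iff_of_false (not_lt.2 (show 0 ≤ (1 + x)⁻¹ by positivity)) id)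
    rw [e1, e2]; ring
  have hprob : IsProbabilityMeasure (SternBrocot.step α μ) := by
    have hm := h.step_real hα MeasurableSet.univ
    rw [Set.preimage_univ, Set.preimage_univ, probReal_univ (μ := μ)] at hm
    refine ⟨?_⟩
    rw [measureReal_def] at hm
    rw [← ENNReal.toReal_eq_one_iff, hm]; ring
  refine ⟨hprob, ?_, ?_, ?_⟩
  · exact (measureReal_eq_zero_iff).1 hneg
  · intro r a b c d hI hr
    rcases r with _ | r
    · cases hI
      have e1 := h.step_real_left hα IsInterval.root
      have e2 := h.step_real_right hα IsInterval.root
      have e4 : (SternBrocot.step α μ).real (interval 0 1 1 0) = 1 := by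
        have e : interval 0 1 1 0 = (Set.Iio (0 : ℝ))ᶜ := by ext x; simp [interval]
        have e6 := probReal_compl_eq_one_sub (μ := SternBrocot.step α μ)
          (measurableSet_Iio (a := (0 : ℝ)))
        rw [← e, hneg, sub_zero] at e6
        exact e6
      rw [h.real_root] at e1 e2
      rw [e4]
      exact ⟨e1, e2⟩
    · obtain ⟨p, q, s, t, hJ, ⟨rfl, rfl, rfl, rfl⟩ | ⟨rfl, rfl, rfl, rfl⟩⟩ :=
        hI.exists_preimage r rfl
      · have hr' : Odd r := by
          rw [Nat.even_add_one] at hr; exact Nat.not_even_iff_odd.1 hr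
        have e := h.odd r _ _ _ _ hJ hr'
        have e1 := h.step_real_right hα hJ.left
        have e2 := h.step_real_right hα hJ.right
        have e3 := h.step_real_right hα hJ
        rw [show s + t + (p + q) = (p + s) + (q + t) by ring, add_comm s p]
        rw [e1, e2, e3, e.1, e.2]
        constructor <;> ring
      · have hr' : Odd r := by
          rw [Nat.even_add_one] at hr; exact Nat.not_even_iff_odd.1 hr
        have e := h.odd r _ _ _ _ hJ hr'
        have e1 := h.step_real_left hα hJ.left
        have e2 := h.step_real_left hα hJ.right
        have e3 := h.step_real_left hα hJ
        rw [show s + t + (p + q) = (p + s) + (q + t) by ring, add_comm t q]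
        rw [e1, e2, e3, e.1, e.2]
        constructor <;> ring
  · intro r a b c d hI hr
    rcases r with _ | r
    · simp at hr
    · obtain ⟨p, q, s, t, hJ, ⟨rfl, rfl, rfl, rfl⟩ | ⟨rfl, rfl, rfl, rfl⟩⟩ :=
        hI.exists_preimage r rfl
      · have hr' : Even r := by
          by_contra hc
          exact (Nat.not_even_iff_odd.2 hr) (Nat.even_add_one.2 hc)
        have e := h.even r _ _ _ _ hJ hr'
        have e1 := h.step_real_right hα hJ.left
        have e2 := h.step_real_right hα hJ.right
        have e3 := h.step_real_right hα hJ
        rw [show s + t + (p + q) = (p + s) + (q + t) by ring, add_comm s p]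
        rw [e1, e2, e3, e.1, e.2]
        constructor <;> ring
      · have hr' : Even r := by
          by_contra hc
          exact (Nat.not_even_iff_odd.2 hr) (Nat.even_add_one.2 hc)
        have e := h.even r _ _ _ _ hJ hr'
        have e1 := h.step_real_left hα hJ.left
        have e2 := h.step_real_left hα hJ.right
        have e3 := h.step_real_left hα hJ
        rw [show s + t + (p + q) = (p + s) + (q + t) by ring, add_comm t q]
        rw [e1, e2, e3, e.1, e.2]
        constructor <;> ring

theorem IsNu.step_eq {α : ℝ} {μ : Measure ℝ} (h : IsNu α μ) (hα : α ∈ Set.Icc (0 : ℝ) 1) :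
    SternBrocot.step α μ = μ :=
  (h.step hα).unique h

theorem IsNu.integral_eq {α : ℝ} {μ : Measure ℝ} (h : IsNu α μ) (hα : α ∈ Set.Icc (0 : ℝ) 1)
    {f : ℝ → ℝ} (hf : Measurable f) (h1 : Integrable (fun x => f (1 + x⁻¹)) μ)
    (h2 : Integrable (fun x => f (1 + x)⁻¹) μ) :
    ∫ x, f x ∂μ = α * ∫ x, f (1 + x⁻¹) ∂μ + (1 - α) * ∫ x, f (1 + x)⁻¹ ∂μ := by
  have h0 : 0 ≤ 1 - α := by linarith [hα.2]
  conv_lhs => rw [← h.step_eq hα]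
  rw [SternBrocot.step, integral_add_measure, integral_smul_measure, integral_smul_measure,
    integral_map measurable_one_add_inv.aemeasurable hf.aestronglyMeasurable,
    integral_map measurable_inv_one_add.aemeasurable hf.aestronglyMeasurable,
    ENNReal.toReal_ofReal hα.1, ENNReal.toReal_ofReal h0]
  · rfl
  · refine Integrable.smul_measure ?_ ENNReal.ofReal_ne_top
    exact (integrable_map_measure hf.aestronglyMeasurable
      measurable_one_add_inv.aemeasurable).2 h1
  · refine Integrable.smul_measure ?_ ENNReal.ofReal_ne_top
    exact (integrable_map_measure hf.aestronglyMeasurable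
      measurable_inv_one_add.aemeasurable).2 h2

/-! ### Moments -/

/-- Monotone convergence. Truncation is needed because stationarity bounds a mean by a fraction of
itself, which is informative only once that mean is known to be finite. -/
theorem integrable_of_integral_min_le {Ω : Type*} [MeasurableSpace Ω] {μ : Measure Ω}
    [IsProbabilityMeasure μ] {f : Ω → ℝ} (hf : Measurable f) (h0 : ∀ᵐ x ∂μ, 0 ≤ f x) {C : ℝ}
    (hC : ∀ N : ℕ, ∫ x, min (f x) N ∂μ ≤ C) : Integrable f μ := by
  refine ⟨hf.aestronglyMeasurable, (hasFiniteIntegral_iff_ofReal h0).2 ?_⟩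
  have hm : Monotone fun (N : ℕ) x => ENNReal.ofReal (min (f x) N) := fun m n hmn x =>
    ENNReal.ofReal_le_ofReal (min_le_min_left _ (by exact_mod_cast hmn))
  have e : ∀ x, ENNReal.ofReal (f x) = ⨆ N : ℕ, ENNReal.ofReal (min (f x) N) := by
    intro x
    refine le_antisymm ?_ (iSup_le fun N => ENNReal.ofReal_le_ofReal (min_le_left _ _))
    obtain ⟨N, hN⟩ := exists_nat_ge (f x)
    refine le_iSup_of_le N ?_
    rw [min_eq_left hN]
  simp_rw [e]
  rw [lintegral_iSup (fun N => by fun_prop) hm]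
  refine lt_of_le_of_lt (iSup_le fun N => ?_) (ENNReal.ofReal_lt_top (r := C))
  have h0N : 0 ≤ᵐ[μ] fun x => min (f x) N := by
    filter_upwards [h0] with x hx
    exact le_min hx (Nat.cast_nonneg N)
  rw [← ofReal_integral_eq_lintegral_ofReal ?_ h0N]
  · exact ENNReal.ofReal_le_ofReal (hC N)
  · refine Integrable.of_bound (by fun_prop) (N : ℝ) ?_
    filter_upwards [h0N] with x hx
    rw [Real.norm_of_nonneg hx]
    exact min_le_right _ _

/-- Let u and v be the two truncated means. Stationarity gives u ≤ 1 + αv and v ≤ 1 + (1 - α)u,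
hence u ≤ 1 + α + α(1 - α)u ≤ 2 + u/4. The constants 4 and 5 are not sharp; what matters is that
they do not depend on N. -/
theorem IsNu.integral_min_le {α : ℝ} {μ : Measure ℝ} (h : IsNu α μ)
    (hα : α ∈ Set.Icc (0 : ℝ) 1) (N : ℕ) :
    ∫ x, min x N ∂μ ≤ 4 ∧ ∫ x, min x⁻¹ N ∂μ ≤ 5 := by
  have := h.isProbabilityMeasure
  have hN : (0 : ℝ) ≤ N := Nat.cast_nonneg N
  have hint : ∀ f : ℝ → ℝ, Measurable f → (∀ x, 0 < x → 0 ≤ f x) →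
      Integrable (fun x => min (f x) N) μ := by
    intro f hf h0
    refine Integrable.of_bound (by fun_prop) (N : ℝ) ?_
    filter_upwards [h.ae_pos hα] with x hx
    rw [Real.norm_of_nonneg (le_min (h0 x hx) hN)]
    exact min_le_right _ _
  have i1 := hint (fun x => x) (by fun_prop) (fun x hx => hx.le)
  have i2 := hint (fun x => x⁻¹) (by fun_prop) (fun x hx => by positivity)
  have i3 := hint (fun x => 1 + x⁻¹) (by fun_prop) (fun x hx => by positivity)
  have i4 := hint (fun x => (1 + x)⁻¹) (by fun_prop) (fun x hx => by positivity)
  have i5 := hint (fun x => (1 + x⁻¹)⁻¹) (by fun_prop) (fun x hx => by positivity)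
  have i6 := hint (fun x => ((1 + x)⁻¹)⁻¹) (by fun_prop) (fun x hx => by positivity)
  have e1 := h.integral_eq hα (f := fun x => min x N) (by fun_prop) i3 i4
  have e2 := h.integral_eq hα (f := fun x => min x⁻¹ N) (by fun_prop) i5 i6
  have hmin : ∀ y : ℝ, min (1 + y) (N : ℝ) ≤ 1 + min y N := fun y => by
    rw [← min_add_add_left]; exact min_le_min_left _ (by linarith)
  have b3 : ∫ x, min (1 + x⁻¹) (N : ℝ) ∂μ ≤ 1 + ∫ x, min x⁻¹ N ∂μ := by
    have : ∫ x, (1 + min x⁻¹ (N : ℝ)) ∂μ = 1 + ∫ x, min x⁻¹ N ∂μ := by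
      rw [integral_add (integrable_const _) i2]; simp
    rw [← this]
    exact integral_mono i3 ((integrable_const _).add i2) fun x => hmin _
  have b6 : ∫ x, min ((1 + x)⁻¹)⁻¹ (N : ℝ) ∂μ ≤ 1 + ∫ x, min x N ∂μ := by
    have : ∫ x, (1 + min x (N : ℝ)) ∂μ = 1 + ∫ x, min x N ∂μ := by
      rw [integral_add (integrable_const _) i1]; simp
    rw [← this]
    exact integral_mono i6 ((integrable_const _).add i1) fun x => by
      simp only [inv_inv]; exact hmin _
  have hone : ∀ f : ℝ → ℝ, Integrable (fun x => min (f x) (N : ℝ)) μ → (∀ x, 0 < x → f x ≤ 1) →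
      ∫ x, min (f x) (N : ℝ) ∂μ ≤ 1 := by
    intro f hf h1
    have : ∫ x, (1 : ℝ) ∂μ = 1 := by simp
    rw [← this]
    refine integral_mono_ae hf (integrable_const _) ?_
    filter_upwards [h.ae_pos hα] with x hx
    exact (min_le_left _ _).trans (h1 x hx)
  have b4 := hone _ i4 fun x hx => inv_le_one_of_one_le₀ (by linarith)
  have b5 := hone _ i5 fun x hx => inv_le_one_of_one_le₀ (by
    have : 0 < x⁻¹ := by positivity
    linarith)
  obtain ⟨ha0, ha1⟩ := hα
  have hb : 0 ≤ 1 - α := by linarith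
  have u1 := add_le_add (mul_le_mul_of_nonneg_left b3 ha0) (mul_le_mul_of_nonneg_left b4 hb)
  have u2 := add_le_add (mul_le_mul_of_nonneg_left b5 ha0) (mul_le_mul_of_nonneg_left b6 hb)
  rw [← e1] at u1
  rw [← e2] at u2
  set u := ∫ x, min x (N : ℝ) ∂μ
  set v := ∫ x, min x⁻¹ (N : ℝ) ∂μ
  have hu0 : 0 ≤ u := integral_nonneg_of_ae (by
    filter_upwards [h.ae_pos ⟨ha0, ha1⟩] with x hx using le_min hx.le hN)
  have u3 := mul_le_mul_of_nonneg_left u2 ha0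
  have h4 : α * (1 - α) * u ≤ 1 / 4 * u :=
    mul_le_mul_of_nonneg_right (by nlinarith [sq_nonneg (α - 1 / 2)]) hu0
  have hu : u ≤ 4 := by nlinarith
  exact ⟨hu, by nlinarith⟩

theorem IsNu.integrable_id {α : ℝ} {μ : Measure ℝ} (h : IsNu α μ)
    (hα : α ∈ Set.Icc (0 : ℝ) 1) : Integrable (fun x => x) μ := by
  have := h.isProbabilityMeasure
  refine integrable_of_integral_min_le measurable_id ?_ fun N => (h.integral_min_le hα N).1
  filter_upwards [h.ae_pos hα] with x hx using hx.le

theorem IsNu.integrable_inv {α : ℝ} {μ : Measure ℝ} (h : IsNu α μ)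
    (hα : α ∈ Set.Icc (0 : ℝ) 1) : Integrable (fun x => x⁻¹) μ := by
  have := h.isProbabilityMeasure
  refine integrable_of_integral_min_le measurable_inv ?_ fun N => (h.integral_min_le hα N).2
  filter_upwards [h.ae_pos hα] with x hx using (inv_pos.2 hx).le

/-- From 1 - 1/x ≤ log x ≤ x - 1 follows |log x| ≤ x + 1/x. -/
theorem IsNu.integrable_log {α : ℝ} {μ : Measure ℝ} (h : IsNu α μ)
    (hα : α ∈ Set.Icc (0 : ℝ) 1) : Integrable Real.log μ := by
  refine ((h.integrable_id hα).add (h.integrable_inv hα)).mono'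
    Real.measurable_log.aestronglyMeasurable ?_
  filter_upwards [h.ae_pos hα] with x hx
  have h1 := Real.log_le_sub_one_of_pos hx
  have h2 := Real.one_sub_inv_le_log_of_pos hx
  have h3 : 0 < x⁻¹ := inv_pos.2 hx
  rw [Real.norm_eq_abs, abs_le]
  constructor <;> simp only [Pi.add_apply] <;> linarith

theorem IsNu.integrable_log_one_add {α : ℝ} {μ : Measure ℝ} (h : IsNu α μ)
    (hα : α ∈ Set.Icc (0 : ℝ) 1) : Integrable (fun x => Real.log (1 + x)) μ := by
  refine (h.integrable_id hα).mono'
    (Real.measurable_log.comp (measurable_const_add 1)).aestronglyMeasurable ?_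
  filter_upwards [h.ae_pos hα] with x hx
  rw [Real.norm_of_nonneg (Real.log_nonneg (by linarith))]
  linarith [Real.log_le_sub_one_of_pos (show 0 < 1 + x by linarith)]

/-! ### The relation between the two logarithmic integrals -/

theorem log_one_add_inv {x : ℝ} (hx : 0 < x) :
    Real.log (1 + x⁻¹) = Real.log (1 + x) - Real.log x := by
  rw [← Real.log_div (by positivity) hx.ne']
  congr 1
  field_simp
  ring

/-- Stationarity for log closes up: log(1 + 1/x) = log(1 + x) - log x, and log(1/(1 + x)) = -log(1 +
x). -/
theorem IsNu.integral_log {α : ℝ} {μ : Measure ℝ} (h : IsNu α μ)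
    (hα : α ∈ Set.Icc (0 : ℝ) 1) :
    (1 + α) * ∫ x, Real.log x ∂μ = (2 * α - 1) * ∫ x, Real.log (1 + x) ∂μ := by
  have hl := h.integrable_log hα
  have hm := h.integrable_log_one_add hα
  have ae1 : (fun x => Real.log (1 + x) - Real.log x) =ᵐ[μ] fun x => Real.log (1 + x⁻¹) := by
    filter_upwards [h.ae_pos hα] with x hx using (log_one_add_inv hx).symm
  have e := h.integral_eq hα Real.measurable_log ((hm.sub hl).congr ae1)
    (by simp only [Real.log_inv]; exact hm.neg)
  rw [← integral_congr_ae ae1, integral_sub hm hl] at e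
  simp only [Real.log_inv, integral_neg] at e
  linear_combination e

/-! ### Difference formula -/

section

variable {α β : ℝ} {μ ν : Measure ℝ}

/-- Since x ≤ x + y + xy ≤ (1 + x)(1 + y), the bound is a sum of functions of one variable,
integrable for each factor and for the product measure. -/
theorem abs_log_add_add_mul_le {x y : ℝ} (hx : 0 < x) (hy : 0 < y) :
    |Real.log (x + y + x * y)| ≤ |Real.log x| + Real.log (1 + x) + Real.log (1 + y) := by
  have hxy : 0 < x * y := mul_pos hx hy
  have h1 : Real.log x ≤ Real.log (x + y + x * y) := Real.log_le_log hx (by linarith)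
  have h2 : Real.log (x + y + x * y) ≤ Real.log ((1 + x) * (1 + y)) :=
    Real.log_le_log (by linarith) (by linarith)
  rw [Real.log_mul (by linarith) (by linarith)] at h2
  have h3 : 0 ≤ Real.log (1 + x) := Real.log_nonneg (by linarith)
  have h4 : 0 ≤ Real.log (1 + y) := Real.log_nonneg (by linarith)
  have := neg_abs_le (Real.log x)
  have := abs_nonneg (Real.log x)
  rw [abs_le]
  constructor <;> linarith

theorem abs_log_one_add_add_le {x y : ℝ} (hx : 0 < x) (hy : 0 < y) :
    |Real.log (1 + x + y)| ≤ Real.log (1 + x) + Real.log (1 + y) := by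
  have hxy : 0 < x * y := mul_pos hx hy
  have h2 : Real.log (1 + x + y) ≤ Real.log ((1 + x) * (1 + y)) :=
    Real.log_le_log (by linarith) (by linarith)
  rw [Real.log_mul (by linarith) (by linarith)] at h2
  rwa [abs_of_nonneg (Real.log_nonneg (by linarith))]

theorem IsNu.ae_pos_prod (hμ : IsNu β μ) (hβ : β ∈ Set.Icc (0 : ℝ) 1) (hν : IsNu α ν)
    (hα : α ∈ Set.Icc (0 : ℝ) 1) : ∀ᵐ z ∂μ.prod ν, 0 < z.1 ∧ 0 < z.2 := by
  have := hμ.isProbabilityMeasure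
  have := hν.isProbabilityMeasure
  exact (Measure.quasiMeasurePreserving_fst.ae (hμ.ae_pos hβ)).and
    (Measure.quasiMeasurePreserving_snd.ae (hν.ae_pos hα))

theorem IsNu.integrable_log_add_add_mul (hν : IsNu α ν) (hα : α ∈ Set.Icc (0 : ℝ) 1) {x : ℝ}
    (hx : 0 < x) : Integrable (fun y => Real.log (x + y + x * y)) ν := by
  have := hν.isProbabilityMeasure
  refine ((integrable_const (|Real.log x| + Real.log (1 + x))).add
    (hν.integrable_log_one_add hα)).mono'
    (Real.measurable_log.comp (by fun_prop)).aestronglyMeasurable ?_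
  filter_upwards [hν.ae_pos hα] with y hy using abs_log_add_add_mul_le hx hy

theorem IsNu.integrable_log_one_add_add (hν : IsNu α ν) (hα : α ∈ Set.Icc (0 : ℝ) 1) {x : ℝ}
    (hx : 0 < x) : Integrable (fun y => Real.log (1 + x + y)) ν := by
  have := hν.isProbabilityMeasure
  refine ((integrable_const (Real.log (1 + x))).add
    (hν.integrable_log_one_add hα)).mono'
    (Real.measurable_log.comp (by fun_prop)).aestronglyMeasurable ?_
  filter_upwards [hν.ae_pos hα] with y hy using abs_log_one_add_add_le hx hy

theorem IsNu.integrable_log_add_add_mul_prod (hμ : IsNu β μ) (hβ : β ∈ Set.Icc (0 : ℝ) 1)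
    (hν : IsNu α ν) (hα : α ∈ Set.Icc (0 : ℝ) 1) :
    Integrable (fun z : ℝ × ℝ => Real.log (z.1 + z.2 + z.1 * z.2)) (μ.prod ν) := by
  have := hμ.isProbabilityMeasure
  have := hν.isProbabilityMeasure
  refine ((((hμ.integrable_log hβ).abs.add (hμ.integrable_log_one_add hβ)).comp_fst ν).add
    ((hν.integrable_log_one_add hα).comp_snd μ)).mono'
    (Real.measurable_log.comp (by fun_prop)).aestronglyMeasurable ?_
  filter_upwards [hμ.ae_pos_prod hβ hν hα] with z hz using abs_log_add_add_mul_le hz.1 hz.2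

theorem IsNu.integrable_log_one_add_add_prod (hμ : IsNu β μ) (hβ : β ∈ Set.Icc (0 : ℝ) 1)
    (hν : IsNu α ν) (hα : α ∈ Set.Icc (0 : ℝ) 1) :
    Integrable (fun z : ℝ × ℝ => Real.log (1 + z.1 + z.2)) (μ.prod ν) := by
  have := hμ.isProbabilityMeasure
  have := hν.isProbabilityMeasure
  refine (((hμ.integrable_log_one_add hβ).comp_fst ν).add
    ((hν.integrable_log_one_add hα).comp_snd μ)).mono'
    (Real.measurable_log.comp (by fun_prop)).aestronglyMeasurable ?_
  filter_upwards [hμ.ae_pos_prod hβ hν hα] with z hz using abs_log_one_add_add_le hz.1 hz.2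

theorem log_quotient_eq {x y : ℝ} (hx : 0 < x) (hy : 0 < y) :
    Real.log ((x + y + x * y) / (x + y + 1)) =
      Real.log (x + y + x * y) - Real.log (1 + x + y) := by
  rw [Real.log_div (by positivity) (by positivity), show x + y + 1 = 1 + x + y by ring]

theorem IsNu.integrable_log_quotient_prod (hμ : IsNu β μ) (hβ : β ∈ Set.Icc (0 : ℝ) 1)
    (hν : IsNu α ν) (hα : α ∈ Set.Icc (0 : ℝ) 1) :
    Integrable (fun z : ℝ × ℝ => Real.log ((z.1 + z.2 + z.1 * z.2) / (z.1 + z.2 + 1)))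
      (μ.prod ν) := by
  refine ((hμ.integrable_log_add_add_mul_prod hβ hν hα).sub
    (hμ.integrable_log_one_add_add_prod hβ hν hα)).congr ?_
  filter_upwards [hμ.ae_pos_prod hβ hν hα] with z hz using (log_quotient_eq hz.1 hz.2).symm

theorem IsNu.integral_log_quotient (hν : IsNu α ν) (hα : α ∈ Set.Icc (0 : ℝ) 1) {x : ℝ}
    (hx : 0 < x) : ∫ y, Real.log ((x + y + x * y) / (x + y + 1)) ∂ν =
      ∫ y, Real.log (x + y + x * y) ∂ν - ∫ y, Real.log (1 + x + y) ∂ν := by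
  rw [← integral_sub (hν.integrable_log_add_add_mul hα hx) (hν.integrable_log_one_add_add hα hx)]
  refine integral_congr_ae ?_
  filter_upwards [hν.ae_pos hα] with y hy using log_quotient_eq hx hy

/-- Here and in the companion identity for (1 + y)⁻¹, the numerators x + y + xy and 1 + x + y are
symmetric in x and y, and the denominators depend on y alone. This is why log(1 + xy) is the right
kernel. -/
theorem log_one_add_mul_one_add_inv {x y : ℝ} (hx : 0 < x) (hy : 0 < y) :
    Real.log (1 + x * (1 + y⁻¹)) = Real.log (x + y + x * y) - Real.log y := by
  rw [← Real.log_div (by positivity) hy.ne']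
  congr 1
  field_simp
  ring

theorem log_one_add_mul_inv_one_add {x y : ℝ} (hx : 0 < x) (hy : 0 < y) :
    Real.log (1 + x * (1 + y)⁻¹) = Real.log (1 + x + y) - Real.log (1 + y) := by
  rw [← Real.log_div (by positivity) (by positivity)]
  congr 1
  field_simp
  ring

/-- Stationarity in the second variable of the kernel `log (1 + x y)`. -/
theorem IsNu.integral_log_one_add_mul (hν : IsNu α ν) (hα : α ∈ Set.Icc (0 : ℝ) 1) {x : ℝ}
    (hx : 0 < x) : ∫ y, Real.log (1 + x * y) ∂ν =
      α * (∫ y, Real.log (x + y + x * y) ∂ν - ∫ y, Real.log y ∂ν) +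
        (1 - α) * (∫ y, Real.log (1 + x + y) ∂ν - ∫ y, Real.log (1 + y) ∂ν) := by
  have i1 := hν.integrable_log_add_add_mul hα hx
  have i2 := hν.integrable_log_one_add_add hα hx
  have i3 := hν.integrable_log hα
  have i4 := hν.integrable_log_one_add hα
  have ae1 : (fun y => Real.log (x + y + x * y) - Real.log y) =ᵐ[ν]
      fun y => Real.log (1 + x * (1 + y⁻¹)) := by
    filter_upwards [hν.ae_pos hα] with y hy using (log_one_add_mul_one_add_inv hx hy).symm
  have ae2 : (fun y => Real.log (1 + x + y) - Real.log (1 + y)) =ᵐ[ν]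
      fun y => Real.log (1 + x * (1 + y)⁻¹) := by
    filter_upwards [hν.ae_pos hα] with y hy using (log_one_add_mul_inv_one_add hx hy).symm
  rw [hν.integral_eq hα (f := fun y => Real.log (1 + x * y))
    (Real.measurable_log.comp (by fun_prop)) ((i1.sub i3).congr ae1) ((i2.sub i4).congr ae2),
    ← integral_congr_ae ae1, ← integral_congr_ae ae2, integral_sub i1 i3, integral_sub i2 i4]

/-- Stationarity in the first variable of the kernel `log (1 + x y)`. -/
theorem IsNu.integral_integral_log_one_add_mul (hμ : IsNu β μ) (hβ : β ∈ Set.Icc (0 : ℝ) 1)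
    (hν : IsNu α ν) (hα : α ∈ Set.Icc (0 : ℝ) 1) :
    ∫ x, ∫ y, Real.log (1 + x * y) ∂ν ∂μ =
      β * (∫ x, ∫ y, Real.log (x + y + x * y) ∂ν ∂μ - ∫ x, Real.log x ∂μ) +
        (1 - β) * (∫ x, ∫ y, Real.log (1 + x + y) ∂ν ∂μ - ∫ x, Real.log (1 + x) ∂μ) := by
  have := hμ.isProbabilityMeasure
  have := hν.isProbabilityMeasure
  have i1 := (hμ.integrable_log_add_add_mul_prod hβ hν hα).integral_prod_left
  have i2 := (hμ.integrable_log_one_add_add_prod hβ hν hα).integral_prod_left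
  have i3 := hμ.integrable_log hβ
  have i4 := hμ.integrable_log_one_add hβ
  have ae1 : (fun x => ∫ y, Real.log (x + y + x * y) ∂ν - Real.log x) =ᵐ[μ]
      fun x => ∫ y, Real.log (1 + (1 + x⁻¹) * y) ∂ν := by
    filter_upwards [hμ.ae_pos hβ] with x hx
    have e : ∫ y, (Real.log (x + y + x * y) - Real.log x) ∂ν =
        ∫ y, Real.log (x + y + x * y) ∂ν - Real.log x := by
      rw [integral_sub (hν.integrable_log_add_add_mul hα hx) (integrable_const _)]; simp
    rw [← e]
    refine integral_congr_ae ?_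
    filter_upwards [hν.ae_pos hα] with y hy
    -- By symmetry of the kernel, the identity for the second variable applies with x and y
    -- exchanged.
    rw [mul_comm (1 + x⁻¹) y, log_one_add_mul_one_add_inv hy hx, add_comm y x,
      mul_comm y x]
  have ae2 : (fun x => ∫ y, Real.log (1 + x + y) ∂ν - Real.log (1 + x)) =ᵐ[μ]
      fun x => ∫ y, Real.log (1 + (1 + x)⁻¹ * y) ∂ν := by
    filter_upwards [hμ.ae_pos hβ] with x hx
    have e : ∫ y, (Real.log (1 + x + y) - Real.log (1 + x)) ∂ν =
        ∫ y, Real.log (1 + x + y) ∂ν - Real.log (1 + x) := by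
      rw [integral_sub (hν.integrable_log_one_add_add hα hx) (integrable_const _)]; simp
    rw [← e]
    refine integral_congr_ae ?_
    filter_upwards [hν.ae_pos hα] with y hy
    rw [mul_comm (1 + x)⁻¹ y, log_one_add_mul_inv_one_add hy hx, add_right_comm]
  have hmeas : Measurable fun x => ∫ y, Real.log (1 + x * y) ∂ν :=
    (StronglyMeasurable.integral_prod_right (f := fun x y : ℝ => Real.log (1 + x * y))
      (Real.measurable_log.comp (by fun_prop : Measurable fun z : ℝ × ℝ =>
        1 + z.1 * z.2)).stronglyMeasurable).measurable
  rw [hμ.integral_eq hβ hmeas ((i1.sub i3).congr ae1) ((i2.sub i4).congr ae2),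
    ← integral_congr_ae ae1, ← integral_congr_ae ae2, integral_sub i1 i3, integral_sub i2 i4]

/-- The integral of log(1 + xy) is expanded by stationarity in x (`e1`) and in y (`e2`). The double
integrals in the two expansions agree, so their difference factors through β - α. -/
theorem IsNu.sub_eq (hμ : IsNu β μ) (hβ : β ∈ Set.Icc (0 : ℝ) 1)
    (hν : IsNu α ν) (hα : α ∈ Set.Icc (0 : ℝ) 1) :
    (β * ∫ x, Real.log x ∂μ + (1 - β) * ∫ x, Real.log (1 + x) ∂μ) -
      (α * ∫ x, Real.log x ∂ν + (1 - α) * ∫ x, Real.log (1 + x) ∂ν) =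
      (β - α) * ∫ x, ∫ y, Real.log ((x + y + x * y) / (x + y + 1)) ∂ν ∂μ := by
  have := hμ.isProbabilityMeasure
  have := hν.isProbabilityMeasure
  have i1 := (hμ.integrable_log_add_add_mul_prod hβ hν hα).integral_prod_left
  have i2 := (hμ.integrable_log_one_add_add_prod hβ hν hα).integral_prod_left
  have e1 := hμ.integral_integral_log_one_add_mul hβ hν hα
  have aux : ∀ {F G : ℝ → ℝ}, Integrable F μ → Integrable G μ → ∀ a b c d : ℝ,
      ∫ x, (a * (F x - c) + b * (G x - d)) ∂μ = a * (∫ x, F x ∂μ - c) + b * (∫ x, G x ∂μ - d) := by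
    intro F G hF hG a b c d
    have hF' : Integrable (fun x => a * (F x - c)) μ := (hF.sub (integrable_const c)).const_mul a
    have hG' : Integrable (fun x => b * (G x - d)) μ := (hG.sub (integrable_const d)).const_mul b
    rw [integral_add hF' hG',
      integral_const_mul, integral_const_mul, integral_sub hF (integrable_const _),
      integral_sub hG (integrable_const _)]
    simp
  have e2 : ∫ x, ∫ y, Real.log (1 + x * y) ∂ν ∂μ =
      α * (∫ x, ∫ y, Real.log (x + y + x * y) ∂ν ∂μ - ∫ y, Real.log y ∂ν) +
        (1 - α) * (∫ x, ∫ y, Real.log (1 + x + y) ∂ν ∂μ - ∫ y, Real.log (1 + y) ∂ν) := by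
    rw [integral_congr_ae ((hμ.ae_pos hβ).mono fun x hx => hν.integral_log_one_add_mul hα hx)]
    exact aux i1 i2 _ _ _ _
  have e3 : ∫ x, ∫ y, Real.log ((x + y + x * y) / (x + y + 1)) ∂ν ∂μ =
      ∫ x, ∫ y, Real.log (x + y + x * y) ∂ν ∂μ - ∫ x, ∫ y, Real.log (1 + x + y) ∂ν ∂μ := by
    rw [← integral_sub i1 i2]
    exact integral_congr_ae ((hμ.ae_pos hβ).mono fun x hx => hν.integral_log_quotient hα hx)
  rw [e3]
  linear_combination e1 - e2

end

/-! ### Continuity in the parameter -/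

theorem measurable_decide_lt (p : unitInterval) :
    Measurable fun u : unitInterval => decide (u < p) :=
  measurable_to_bool (by
    convert! (measurableSet_Iio (a := p)) using 1
    ext u; simp)

theorem map_decide_lt (p : unitInterval) :
    (volume : Measure unitInterval).map (fun u => decide (u < p)) = coin p := by
  refine Measure.ext_of_singleton fun b => ?_
  rw [Measure.map_apply (measurable_decide_lt p) (MeasurableSet.of_discrete)]
  cases b with
  | true =>
    rw [coin_true, ← unitInterval.volume_Iio]
    congr 1; ext u; simp
  | false =>
    rw [coin_false, ← unitInterval.volume_Ici]
    congr 1; ext u; simp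

/-- Directions of law `dir α`, as a function of independent uniform variables. -/
noncomputable def coupledDir (α : unitInterval) (u : ℕ → unitInterval) : ℕ → Bool :=
  fun n => decide (u n < if Even n then α else unitInterval.symm α)

theorem measurable_coupledDir (α : unitInterval) : Measurable (coupledDir α) :=
  measurable_pi_lambda _ fun n => (measurable_decide_lt _).comp (measurable_pi_apply n)

theorem map_coupledDir (α : unitInterval) :
    (Measure.infinitePi fun _ : ℕ => (volume : Measure unitInterval)).map (coupledDir α) =
      dir α := by
  have := Measure.infinitePi_map_pi (fun _ : ℕ => (volume : Measure unitInterval))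
    (f := fun n u => decide (u < if Even n then α else unitInterval.symm α))
    (fun n => measurable_decide_lt _)
  unfold coupledDir
  rw [this, dir]
  congr 1
  funext n
  exact map_decide_lt _

/-- The n-th direction is locally constant in the parameter at α unless `u n` equals the threshold,
which has probability zero. The neighbourhood may depend on n. -/
theorem ae_eventually_coupledDir (α : unitInterval) :
    ∀ᵐ u ∂(Measure.infinitePi fun _ : ℕ => (volume : Measure unitInterval)),
      ∀ n, ∀ᶠ β in nhds α, coupledDir β u n = coupledDir α u n := by
  rw [ae_all_iff]
  intro n
  have h : ∀ᵐ u ∂(volume : Measure unitInterval),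
      u ≠ if Even n then α else unitInterval.symm α := by
    rw [ae_iff]; simp
  have h' := (measurePreserving_eval_infinitePi
    (fun _ : ℕ => (volume : Measure unitInterval)) n).quasiMeasurePreserving.ae h
  filter_upwards [h'] with u hu
  have hc : Continuous fun β : unitInterval => if Even n then β else unitInterval.symm β := by
    split_ifs
    · exact continuous_id
    · exact unitInterval.continuous_symm
  simp only [Function.eval, coupledDir] at hu ⊢
  rcases lt_or_gt_of_ne hu with hlt | hgt
  · filter_upwards [hc.continuousAt.eventually (lt_mem_nhds hlt)] with β hβ
    rw [decide_eq_true hlt, decide_eq_true hβ]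
  · filter_upwards [hc.continuousAt.eventually (gt_mem_nhds hgt)] with β hβ
    rw [decide_eq_false hgt.le.not_gt, decide_eq_false hβ.le.not_gt]

/-! ### Continuity of the coding map -/

theorem st_congr {ω ω' : ℕ → Bool} {n : ℕ} (h : ∀ i < n, ω i = ω' i) : st ω n = st ω' n := by
  induction n with
  | zero => rfl
  | succ n ih =>
    simp only [st, ih fun i hi => h i (by omega), h n (by omega)]

/-- Closed bounds hold without goodness, as required for the approximating sequences in
`tendsto_pt`. -/
theorem pt_mem_Icc {ω : ℕ → Bool} {n a b c d : ℕ} (hs : st ω n = (a, b, c, d)) (hd : 0 < d) :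
    pt ω ∈ Set.Icc ((a : ℝ) / b) ((c : ℝ) / d) := by
  refine ⟨?_, ciSup_le fun k => lo_le ω hs hd k⟩
  have hbdd : BddAbove (Set.range (lo ω)) := ⟨_, by rintro _ ⟨k, rfl⟩; exact lo_le ω hs hd k⟩
  have h : lo ω n ≤ pt ω := le_ciSup hbdd n
  simpa only [lo, hs] using h

/-- Each step adds one denominator to the other. Both are positive once the right endpoint is
finite, so their sum grows by at least 1. -/
theorem st_denominators (ω : ℕ → Bool) {n a b c d : ℕ} (hs : st ω n = (a, b, c, d)) (hd : 0 < d)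
    (k : ℕ) : ∀ a' b' c' d', st ω (n + k) = (a', b', c', d') → 0 < d' ∧ k ≤ b' + d' := by
  induction k with
  | zero =>
    intro a' b' c' d' h
    rw [add_zero, hs] at h
    simp only [Prod.mk.injEq] at h
    omega
  | succ k ih =>
    intro a' b' c' d' h
    obtain ⟨⟨a₁, b₁, c₁, d₁⟩, hs₁⟩ : ∃ s, st ω (n + k) = s := ⟨_, rfl⟩
    have h1 := ih _ _ _ _ hs₁
    have h2 := (st_inv ω _ _ _ _ _ hs₁).1
    rw [← add_assoc] at h
    cases hb : ω (n + k) with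
    | true =>
      rw [st_true hs₁ hb] at h
      simp only [Prod.mk.injEq] at h
      omega
    | false =>
      rw [st_false hs₁ hb] at h
      simp only [Prod.mk.injEq] at h
      omega

theorem exists_small {ω : ℕ → Bool} (hω : Good ω) {ε : ℝ} (hε : 0 < ε) :
    ∃ n a b c d, st ω n = (a, b, c, d) ∧ 0 < d ∧ (c : ℝ) / d - (a : ℝ) / b < ε := by
  -- A left turn makes the right endpoint finite; as long as all turns are right, it stays 1/0.
  obtain ⟨m, -, hm⟩ := hω false 0
  obtain ⟨⟨a₁, b₁, c₁, d₁⟩, hs₁⟩ : ∃ s, st ω m = s := ⟨_, rfl⟩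
  have hb₁ := (st_inv ω _ _ _ _ _ hs₁).1
  have hs₂ := st_false hs₁ hm
  obtain ⟨k, hk⟩ := exists_nat_gt (1 / ε)
  obtain ⟨⟨a, b, c, d⟩, hs⟩ : ∃ s, st ω (m + 1 + (k + 1)) = s := ⟨_, rfl⟩
  obtain ⟨hd, hbd⟩ := st_denominators ω hs₂ (by omega) (k + 1) _ _ _ _ hs
  obtain ⟨hb, hdet⟩ := st_inv ω _ _ _ _ _ hs
  refine ⟨_, a, b, c, d, hs, hd, ?_⟩
  have hb' : (0 : ℝ) < b := by exact_mod_cast hb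
  have hd' : (0 : ℝ) < d := by exact_mod_cast hd
  have hdet' : (b : ℝ) * c = a * d + 1 := by exact_mod_cast hdet
  have hk' : (k : ℝ) ≤ b * d := by
    -- For b, d ≥ 1, bd ≥ b + d - 1; this is why k + 1 further steps are taken. The length of the
    -- interval is 1/(bd).
    have : k ≤ b * d := by nlinarith
    exact_mod_cast this
  have e : (c : ℝ) / d - (a : ℝ) / b = 1 / (b * d) := by
    field_simp
    linear_combination hdet'
  rw [e, div_lt_iff₀ (by positivity)]
  rw [div_lt_iff₀ hε] at hk
  nlinarith

/-- Agreement on the first n directions puts both points in one interval of rank n, and its length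
is small for suitable n. -/
theorem tendsto_pt {ι : Type*} {l : Filter ι} {ω : ℕ → Bool} (hω : Good ω) {w : ι → ℕ → Bool}
    (hw : ∀ n, ∀ᶠ i in l, w i n = ω n) : Filter.Tendsto (fun i => pt (w i)) l (nhds (pt ω)) := by
  rw [Metric.tendsto_nhds]
  intro ε hε
  obtain ⟨n, a, b, c, d, hs, hd, hlt⟩ := exists_small hω hε
  have hall : ∀ᶠ i in l, ∀ k ∈ Finset.range n, w i k = ω k :=
    (Filter.eventually_all_finset _).2 fun k _ => hw k
  filter_upwards [hall] with i hi
  have h1 := pt_mem_Icc hs hd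
  have h2 := pt_mem_Icc ((st_congr fun k hk => hi k (Finset.mem_range.2 hk)).trans hs) hd
  exact (Real.dist_le_of_mem_Icc h2 h1).trans_lt hlt

/-- All the ν_α are realised on one probability space, so that dominated convergence can be used in
α. -/
theorem integral_nu_eq (α : unitInterval) {g : ℝ → ℝ} (hg : Measurable g) :
    ∫ x, g x ∂(nu α) = ∫ u, g (pt (coupledDir α u))
      ∂(Measure.infinitePi fun _ : ℕ => (volume : Measure unitInterval)) := by
  rw [(nu_spec α.2).unique (isNu_map α), integral_map measurable_pt.aemeasurable
    hg.aestronglyMeasurable, ← map_coupledDir,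
    integral_map (measurable_coupledDir α).aemeasurable
      (f := fun ω => g (pt ω)) (hg.comp measurable_pt).aestronglyMeasurable]

/-- `ν_α` depends continuously on `α`, for the weak convergence of measures on `(0, ∞)`. -/
theorem continuous_integral_nu {g : ℝ → ℝ} (hg : Measurable g) {C : ℝ}
    (hC : ∀ x, 0 < x → |g x| ≤ C) (hcont : ∀ x, 0 < x → ContinuousAt g x) :
    Continuous fun α : unitInterval => ∫ x, g x ∂(nu α) := by
  rw [continuous_iff_continuousAt]
  intro α
  simp_rw [ContinuousAt, integral_nu_eq _ hg]
  have hpos : ∀ β : unitInterval, ∀ᵐ u ∂(Measure.infinitePi fun _ : ℕ =>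
      (volume : Measure unitInterval)), Good (coupledDir β u) ∧ 0 < pt (coupledDir β u) := by
    intro β
    have h := ae_good β
    rw [← map_coupledDir] at h
    filter_upwards [ae_of_ae_map (measurable_coupledDir β).aemeasurable h] with u hu
    refine ⟨hu, ?_⟩
    simpa using (pt_mem hu (n := 0) (a := 0) (b := 1) (c := 1) (d := 0) rfl).1
  refine tendsto_integral_filter_of_dominated_convergence (fun _ => C)
    (Filter.Eventually.of_forall fun β =>
      (hg.comp (measurable_pt.comp (measurable_coupledDir β))).aestronglyMeasurable)
    (Filter.Eventually.of_forall fun β => (hpos β).mono fun u hu => hC _ hu.2)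
    (integrable_const _) ?_
  filter_upwards [hpos α, ae_eventually_coupledDir α] with u hu hev
  exact (hcont _ hu.2).tendsto.comp (tendsto_pt hu.1 hev)

/-- As x runs from 0 to ∞, the quotient increases from y/(1 + y) to 1 + y. The bound is therefore
uniform in x. -/
theorem abs_log_quotient_le {x y : ℝ} (hx : 0 < x) (hy : 0 < y) :
    |Real.log ((x + y + x * y) / (x + y + 1))| ≤ Real.log (1 + y) + |Real.log y| := by
  have hxy : 0 < x * y := mul_pos hx hy
  have h1 : Real.log ((x + y + x * y) / (x + y + 1)) ≤ Real.log (1 + y) := by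
    refine Real.log_le_log (by positivity) ?_
    rw [div_le_iff₀ (by positivity)]
    nlinarith
  have h2 : Real.log (y / (1 + y)) ≤ Real.log ((x + y + x * y) / (x + y + 1)) := by
    refine Real.log_le_log (by positivity) ?_
    rw [div_le_div_iff₀ (by positivity) (by positivity)]
    nlinarith [mul_pos hxy hy]
  rw [Real.log_div hy.ne' (by positivity)] at h2
  have := neg_abs_le (Real.log y)
  have := abs_nonneg (Real.log y)
  rw [abs_le]
  constructor <;> linarith

theorem measurable_log_quotient :
    Measurable fun z : ℝ × ℝ => Real.log ((z.1 + z.2 + z.1 * z.2) / (z.1 + z.2 + 1)) :=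
  Real.measurable_log.comp (by fun_prop)

/-- Only the outer measure moves. The inner integral is bounded and continuous in x > 0, by
domination with a function of y alone, so weak continuity of ν_β suffices. -/
theorem continuous_integral_log_quotient {α : ℝ} {ν : Measure ℝ} (hν : IsNu α ν)
    (hα : α ∈ Set.Icc (0 : ℝ) 1) :
    Continuous fun β : unitInterval =>
      ∫ x, ∫ y, Real.log ((x + y + x * y) / (x + y + 1)) ∂ν ∂(nu β) := by
  have := hν.isProbabilityMeasure
  have hk : Integrable (fun y => Real.log (1 + y) + |Real.log y|) ν :=
    (hν.integrable_log_one_add hα).add (hν.integrable_log hα).abs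
  refine continuous_integral_nu (C := ∫ y, (Real.log (1 + y) + |Real.log y|) ∂ν) ?_ ?_ ?_
  · exact (StronglyMeasurable.integral_prod_right
      (f := fun x y : ℝ => Real.log ((x + y + x * y) / (x + y + 1)))
      measurable_log_quotient.stronglyMeasurable).measurable
  · intro x hx
    rw [← Real.norm_eq_abs]
    refine norm_integral_le_of_norm_le hk ?_
    filter_upwards [hν.ae_pos hα] with y hy using abs_log_quotient_le hx hy
  · intro x hx
    refine continuousAt_of_dominated (bound := fun y => Real.log (1 + y) + |Real.log y|)
      (Filter.Eventually.of_forall fun x' => (measurable_log_quotient.comp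
        measurable_prodMk_left).aestronglyMeasurable) ?_ hk ?_
    · filter_upwards [lt_mem_nhds hx] with x' hx'
      filter_upwards [hν.ae_pos hα] with y hy using abs_log_quotient_le hx' hy
    · filter_upwards [hν.ae_pos hα] with y hy
      refine ContinuousAt.log (ContinuousAt.div (by fun_prop) (by fun_prop) (by positivity)) ?_
      positivity

/-! ### Derivative -/

/-- `∫ (α log x + (1 - α) log (1 + x)) dν_α(x)`, which is a multiple of `γ(α)`. -/
noncomputable def potential (α : ℝ) : ℝ :=
  α * ∫ x, Real.log x ∂(nu α) + (1 - α) * ∫ x, Real.log (1 + x) ∂(nu α)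

theorem potential_mul {α : ℝ} (hα : α ∈ Set.Icc (0 : ℝ) 1) :
    (2 * α - 1) * potential α = (α ^ 2 - α + 1) * gammaLyap α := by
  rw [potential, gammaLyap]
  linear_combination (-(1 - α)) * (nu_spec hα).integral_log hα

theorem gammaLyap_eq {α : ℝ} (hα : α ∈ Set.Icc (0 : ℝ) 1) :
    gammaLyap α = potential α * ((2 * α - 1) / (α ^ 2 - α + 1)) := by
  have hq : α ^ 2 - α + 1 ≠ 0 := by nlinarith [sq_nonneg (α - 1 / 2)]
  rw [mul_div_assoc', eq_div_iff hq]
  linear_combination -potential_mul hα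

/-- By `IsNu.sub_eq` the slope between α and β is exactly the double integral against ν_β and ν_α,
so differentiability reduces to continuity in β. -/
theorem hasDerivWithinAt_potential {α : ℝ} (hα : α ∈ Set.Icc (0 : ℝ) 1) :
    HasDerivWithinAt potential
      (∫ x, ∫ y, Real.log ((x + y + x * y) / (x + y + 1)) ∂(nu α) ∂(nu α)) (Set.Icc 0 1) α := by
  have hc : ContinuousWithinAt (fun β : ℝ =>
      ∫ x, ∫ y, Real.log ((x + y + x * y) / (x + y + 1)) ∂(nu α) ∂(nu β)) (Set.Icc 0 1) α := by
    rw [continuousWithinAt_iff_continuousAt_domRestrict _ hα]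
    exact (continuous_integral_log_quotient (nu_spec hα) hα).continuousAt
  rw [hasDerivWithinAt_iff_tendsto_slope]
  refine (hc.tendsto.mono_left (nhdsWithin_mono _ Set.sdiff_subset)).congr' ?_
  filter_upwards [self_mem_nhdsWithin] with β hβ
  have hne : β - α ≠ 0 := sub_ne_zero.2 hβ.2
  rw [slope_def_field, potential, potential,
    (nu_spec hβ.1).sub_eq hβ.1 (nu_spec hα) hα, mul_div_cancel_left₀ _ hne]

end SternBrocot

theorem mainTheorem3 (α : ℝ) (h₀ : 1 / 2 < α) (h₁ : α ≤ 1) :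
    Integrable Real.log (nu α) ∧
    Integrable (fun z : ℝ × ℝ => Real.log ((z.1 + z.2 + z.1 * z.2) / (z.1 + z.2 + 1)))
      ((nu α).prod (nu α)) ∧
    HasDerivWithinAt gammaLyap
      (gammaLyap α * ((1 + 2 * α - 2 * α ^ 2) / ((2 * α - 1) * (α ^ 2 - α + 1))) +
        (2 * α - 1) / (α ^ 2 - α + 1) *
          ∫ z : ℝ × ℝ, Real.log ((z.1 + z.2 + z.1 * z.2) / (z.1 + z.2 + 1))
            ∂((nu α).prod (nu α)))
      (Set.Icc 0 1) α := by
  have hα : α ∈ Set.Icc (0 : ℝ) 1 := ⟨by linarith, h₁⟩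
  have hν := nu_spec hα
  have := hν.isProbabilityMeasure
  have hint := hν.integrable_log_quotient_prod hα hν hα
  refine ⟨hν.integrable_log hα, hint, ?_⟩
  have hq : α ^ 2 - α + 1 ≠ 0 := by nlinarith [sq_nonneg (α - 1 / 2)]
  -- The target formula expresses P(α) as γ(α)(α² - α + 1)/(2α - 1).
  have h2 : 2 * α - 1 ≠ 0 := by linarith
  have hnum : HasDerivAt (fun β : ℝ => 2 * β - 1) 2 α := by
    simpa using ((hasDerivAt_id α).const_mul 2).sub_const 1
  have hden : HasDerivAt (fun β : ℝ => β ^ 2 - β + 1) (2 * α - 1) α := by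
    simpa using (((hasDerivAt_id α).pow 2).sub (hasDerivAt_id α)).add_const 1
  have hd := (SternBrocot.hasDerivWithinAt_potential hα).mul
    (hnum.div hden hq).hasDerivWithinAt
  refine (hd.congr_deriv ?_).congr_of_mem (fun β hβ => SternBrocot.gammaLyap_eq hβ) hα
  -- The factor (2α - 1)/(α² - α + 1) has derivative (1 + 2α - 2α²)/(α² - α + 1)²; writing γ(α)
  -- through P(α) reduces the rest to algebra.
  rw [integral_prod _ hint, SternBrocot.gammaLyap_eq hα]
  simp only [Pi.div_apply]
  field_simp
  ring
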